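/- There exists an infinite family of relations $\mathcal R_i\subseteq\{0,1\}^{M_i}\times\{0,1\}^{N_i}$, $i\in\mathbb N$, with $M_0<M_1<M_2<\cdots$, for which the following two assertions hold. Write $\mathcal R_i(x)=\{z\in\{0,1\}^{N_i} : (x,z)\in\mathcal R_i\}$. 1. There are constants $K$ and $D$ such that for every $i$ there is a quantum circuit of depth at most $D$, made of unitary gates that each act on at most $K$ qubits (gates in the same layer acting on disjoint sets of qubits), which on every input $x\in\{0,1\}^{M_i}$, started in the basis state $|x\rangle$ together with ancilla qubits in the state $|0\rangle$, produces an element of $\mathcal R_i(x)$ with probability $1$ when $N_i$ designated qubits are finally measured in the computational basis. 2. There is a constant $\gamma>0$ such that any family of randomized classical circuits with bounded-fanin gates whose average success probability is at least $\exp(-\gamma\sqrt{M})$ has depth $\Omega(\log M)$. Precisely: there is $\gamma>0$ such that for every fanin bound $k$ there are a constant $c>0$ and an index $i_0$ such that, for all $i\ge i_0$, every randomized Boolean circuit $C$ with $M_i$ input bits and $N_i$ output bits, whose gates compute arbitrary Boolean functions of at most $k$ wires (with unrestricted fanout) and which may use a finite random string whose distribution does not depend on the input, and which satisfies $$\frac{1}{2^{M_i}}\sum_{x\in\{0,1\}^{M_i}}\Pr[C(x)\in\mathcal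 R_i(x)]\;\ge\;\frac{1}{\exp(\gamma\sqrt{M_i})},$$ has depth at least $c\log M_i$. -/

import Mathlib

open Filter

noncomputable section

/-- The set `{0,1}^n` of bit strings of length `n`. -/
abbrev BitString (n : ℕ) : Type := Fin n → Bool

/-! ### Quantum circuits -/

/-- A quantum gate on a register of qubits indexed by `Q`: a unitary operator on the qubits of
the finite set `support`, written as a matrix in the computational basis of these qubits. -/
structure QuantumGate (Q : Type) [DecidableEq Q] where
  support : Finset Q
  op : Matrix (support → Bool) (support → Bool) ℂ
  unitary : op ∈ Matrix.unitaryGroup (support → Bool) ℂ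

/-- The action of a gate (tensored with the identity on the qubits outside its support) on a
vector of amplitudes, indexed by the computational basis of the whole register. -/
def QuantumGate.apply {Q : Type} [DecidableEq Q] (g : QuantumGate Q)
    (ψ : (Q → Bool) → ℂ) : (Q → Bool) → ℂ := fun z =>
  ∑ y : g.support → Bool,
    g.op (fun i => z i) y * ψ (fun i => if h : i ∈ g.support then y ⟨i, h⟩ else z i)

/-- A quantum circuit with `M` input bits and `N` output bits. The register consists of the `M`
input qubits and of finitely many ancilla qubits. The circuit is a sequence of layers, each layer
being a collection of gates that act on pairwise disjoint sets of qubits, and the `N` distinct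
qubits `output` are measured in the computational basis at the end. -/
structure QuantumCircuit (M N : ℕ) where
  ancillas : ℕ
  layers : List (List (QuantumGate (Fin M ⊕ Fin ancillas)))
  disjoint : ∀ L ∈ layers, L.Pairwise fun g h => Disjoint g.support h.support
  output : Fin N ↪ Fin M ⊕ Fin ancillas

namespace QuantumCircuit

variable {M N : ℕ}

/-- The depth of a quantum circuit: its number of layers. -/
def depth (C : QuantumCircuit M N) : ℕ := C.layers.length

/-- Every gate acts on at most `K` qubits. -/
def FaninAtMost (C : QuantumCircuit M N) (K : ℕ) : Prop :=
  ∀ L ∈ C.layers, ∀ g ∈ L, g.support.card ≤ K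

/-- The initial state: `x` on the input qubits and `0` on every ancilla. -/
def initialState (C : QuantumCircuit M N) (x : BitString M) :
    (Fin M ⊕ Fin C.ancillas → Bool) → ℂ :=
  Pi.single (Sum.elim x fun _ => false) 1

/-- The state after all the layers have been applied, the first layer of the list first. -/
def finalState (C : QuantumCircuit M N) (x : BitString M) :
    (Fin M ⊕ Fin C.ancillas → Bool) → ℂ :=
  C.layers.flatten.foldl (fun ψ g => g.apply ψ) (C.initialState x)

open Classical in
/-- The probability that, on input `x`, the measured string belongs to `S` (Born rule). -/
def outputProb (C : QuantumCircuit M N) (x : BitString M) (S : Set (BitString N)) : ℝ :=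
  ∑ w : Fin M ⊕ Fin C.ancillas → Bool,
    if (fun j => w (C.output j)) ∈ S then ‖C.finalState x w‖ ^ 2 else 0

end QuantumCircuit

/-! ### Classical circuits -/

/-- A Boolean circuit with input wires indexed by `I` and `N` output wires: a directed acyclic
graph of gates, listed in a topological order. The gate `g` computes an arbitrary Boolean function
of `fanin g` wires, each of which is an input wire or the output of an earlier gate. The fanout
is not restricted. -/
structure BooleanCircuit (I : Type) (N : ℕ) where
  size : ℕ
  fanin : Fin size → ℕ
  op : (g : Fin size) → (Fin (fanin g) → Bool) → Bool
  arg : (g : Fin size) → Fin (fanin g) → I ⊕ Fin (g : ℕ)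
  output : Fin N → I ⊕ Fin size

namespace BooleanCircuit

variable {I : Type} {N : ℕ}

/-- The value computed by the gate `g` when the input wires carry the bits `x`. -/
def gateValue (C : BooleanCircuit I N) (x : I → Bool) (g : Fin C.size) : Bool :=
  C.op g fun j =>
    match C.arg g j with
    | Sum.inl i => x i
    | Sum.inr h => C.gateValue x ⟨h, h.isLt.trans g.isLt⟩
termination_by (g : ℕ)
decreasing_by exact h.isLt

/-- The string on the output wires when the input wires carry the bits `x`. -/
def eval (C : BooleanCircuit I N) (x : I → Bool) : BitString N := fun j =>
  Sum.elim x (C.gateValue x) (C.output j)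

/-- The depth of the gate `g`: the largest number of gates on a directed path ending in `g`. -/
def gateDepth (C : BooleanCircuit I N) (g : Fin C.size) : ℕ :=
  1 + Finset.univ.sup fun j : Fin (C.fanin g) =>
    match C.arg g j with
    | Sum.inl _ => 0
    | Sum.inr h => C.gateDepth ⟨h, h.isLt.trans g.isLt⟩
termination_by (g : ℕ)
decreasing_by exact h.isLt

/-- The depth of a circuit: the largest depth of a wire that is used as an output (input wires
have depth `0`). -/
def depth (C : BooleanCircuit I N) : ℕ :=
  Finset.univ.sup fun j : Fin N => Sum.elim (fun _ => 0) C.gateDepth (C.output j)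

end BooleanCircuit

/-- A randomized circuit with `M` input bits and `N` output bits: a Boolean circuit that receives,
besides its input, a random string of finite length, whose distribution does not depend on the
input (uniformly distributed random bits are a special case). -/
structure RandomizedCircuit (M N : ℕ) where
  randomBits : ℕ
  dist : PMF (BitString randomBits)
  circuit : BooleanCircuit (Fin M ⊕ Fin randomBits) N

namespace RandomizedCircuit

variable {M N : ℕ}

/-- The depth of a randomized circuit. -/
def depth (C : RandomizedCircuit M N) : ℕ := C.circuit.depth

/-- Every gate has fanin at most `k`. -/
def FaninAtMost (C : RandomizedCircuit M N) (k : ℕ) : Prop :=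
  ∀ g, C.circuit.fanin g ≤ k

open Classical in
/-- The probability, over the random string, that on input `x` the output belongs to `S`. -/
def outputProb (C : RandomizedCircuit M N) (x : BitString M) (S : Set (BitString N)) : ℝ :=
  ∑ r : BitString C.randomBits,
    if C.circuit.eval (Sum.elim x r) ∈ S then (C.dist r).toReal else 0

end RandomizedCircuit

/-- The valid outputs `R(x) = {z | (x, z) ∈ R}` on input `x`. -/
def validOutputs {M N : ℕ} (R : Set (BitString M × BitString N)) (x : BitString M) :
    Set (BitString N) :=
  {z | (x, z) ∈ R}

/-- The success probability of a randomized circuit for the relation `R`, averaged over all the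
inputs. -/
def RandomizedCircuit.averageSuccess {M N : ℕ} (C : RandomizedCircuit M N)
    (R : Set (BitString M × BitString N)) : ℝ :=
  1 / 2 ^ M * ∑ x : BitString M, C.outputProb x (validOutputs R x)

end

/-! Each game imitates measuring a graph state on a torus with subdivided edges: the edge qubits in
the basis X, the qubit of a vertex in X or, where the input bit is 1, in Y. The edge outcomes force
the vertex qubits into a labelling z with that coboundary or into its complement, a GHZ-like
superposition. The two branches differ by the phase i^(|x| + 2 x⬝z + 2|y|), and when this is -1 they
cancel. `Valid` forbids only outcomes of amplitude 0 (`finalState_eq_zero`), so a circuit of depth 7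
always wins.

Suppose now that every output bit depends on few input bits. By counting, some three vertices u, v,
w are pairwise `Separated`. Among the eight inputs that agree off u, v, w, four have even weight; a
winning answer on these has phase exponent 0 mod 4. Adding the four exponents gives 2 = 0 mod 4, a
Mermin-type contradiction: no label sees two of the toggled bits, so the labels cancel, and the
potentials z are compared along row-and-column paths blind to the third bit. Hence each orbit of
eight inputs contains a losing one (`exists_toggle_not_valid`).

Many tori amplify this. A greedy choice gives s tori, none influencing the answers of another, and
`card_pow_mul_card_forall_le` bounds the winning fraction by (7/8)^s. With L^12 tori of side L, M =
L^14. Depth below log M / (28 log k) makes light cones of size at most √L, so s ≥ L^9 and the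
success is at most exp(-L^9/8) < exp(-L^7) = exp(-√M). Randomness only averages deterministic
circuits. -/

namespace QuantumGate

/-! ### Norm preservation and the explicit gates. -/

variable {Q : Type} [DecidableEq Q]

/-- The squared norm of a state is preserved by every gate. -/
theorem sum_norm_sq_apply [Fintype Q] (g : QuantumGate Q) (ψ : (Q → Bool) → ℂ) :
    ∑ w, ‖g.apply ψ w‖ ^ 2 = ∑ w, ‖ψ w‖ ^ 2 := by
  classical
  -- Splitting the register into the support and its complement, the gate acts as a unitary matrix
  -- on each fibre over the complement.
  let e := Equiv.piEquivPiSubtypeProd (fun i => i ∈ g.support) (fun _ : Q => Bool)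
  have key : ∀ v : (g.support → Bool) → ℂ,
      ∑ s, ‖(g.op.mulVec v) s‖ ^ 2 = ∑ s, ‖v s‖ ^ 2 := by
    intro v
    have h1 : star (g.op.mulVec v) ⬝ᵥ g.op.mulVec v = star v ⬝ᵥ v := by
      rw [Matrix.star_mulVec, Matrix.dotProduct_mulVec, Matrix.vecMul_vecMul,
        ← Matrix.star_eq_conjTranspose, Matrix.mem_unitaryGroup_iff'.1 g.unitary,
        Matrix.vecMul_one]
    have h2 : ∀ v : (g.support → Bool) → ℂ,
        star v ⬝ᵥ v = ((∑ s, ‖v s‖ ^ 2 : ℝ) : ℂ) := by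
      intro v
      simp only [dotProduct, Pi.star_apply, RCLike.star_def, Complex.conj_mul']
      push_cast
      rfl
    rw [h2, h2] at h1
    exact_mod_cast h1
  have split : ∀ φ : (Q → Bool) → ℂ, ∑ w, ‖φ w‖ ^ 2 =
      ∑ t, ∑ s, ‖φ (e.symm (s, t))‖ ^ 2 := by
    intro φ
    rw [← Equiv.sum_comp e.symm fun w => ‖φ w‖ ^ 2, Fintype.sum_prod_type, Finset.sum_comm]
  rw [split, split]
  refine Finset.sum_congr rfl fun t _ => ?_
  rw [← key fun s => ψ (e.symm (s, t))]
  refine Finset.sum_congr rfl fun s _ => ?_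
  congr 2
  simp only [QuantumGate.apply, Matrix.mulVec, dotProduct]
  refine Finset.sum_congr rfl fun y _ => ?_
  have hs : (fun i : g.support => e.symm (s, t) i) = s := by
    funext i
    simp [e, Equiv.piEquivPiSubtypeProd]
  have hy : (fun i => if h : i ∈ g.support then y ⟨i, h⟩ else e.symm (s, t) i) =
      e.symm (y, t) := by
    funext i
    by_cases h : i ∈ g.support <;> simp [e, Equiv.piEquivPiSubtypeProd, h]
  rw [hs, hy]

theorem sum_norm_sq_foldl [Fintype Q] (l : List (QuantumGate Q)) (ψ : (Q → Bool) → ℂ) :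
    ∑ w, ‖l.foldl (fun ψ g => g.apply ψ) ψ w‖ ^ 2 = ∑ w, ‖ψ w‖ ^ 2 := by
  induction l generalizing ψ with
  | nil => rfl
  | cons g l ih => rw [List.foldl_cons, ih, sum_norm_sq_apply]

/-- The entries of the Hadamard matrix. -/
noncomputable def hadamardEntry (s t : Bool) : ℂ :=
  (√2 : ℂ)⁻¹ * Complex.I ^ (2 * (s.toNat * t.toNat))

/-- The Hadamard gate on the qubit `q`. -/
noncomputable def hadamard (q : Q) : QuantumGate Q where
  support := {q}
  op := Matrix.of fun s t => hadamardEntry (s ⟨q, Finset.mem_singleton_self q⟩)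
    (t ⟨q, Finset.mem_singleton_self q⟩)
  unitary := by
    have h2 : (√2 : ℂ)⁻¹ * (√2 : ℂ)⁻¹ = 2⁻¹ := by
      rw [← mul_inv, ← Complex.ofReal_mul, Real.mul_self_sqrt (by norm_num)]; norm_num
    rw [Matrix.mem_unitaryGroup_iff]
    ext s t
    rw [Matrix.mul_apply, ← Equiv.sum_comp (Equiv.funUnique ({q} : Finset Q) Bool).symm]
    have hst : s = t ↔ s ⟨q, Finset.mem_singleton_self q⟩ = t ⟨q, Finset.mem_singleton_self q⟩ := by
      constructor
      · rintro rfl; rfl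
      · intro h; funext ⟨i, hi⟩
        obtain rfl := Finset.mem_singleton.1 hi
        exact h
    rw [Matrix.one_apply, Fintype.sum_bool]
    simp only [hst, Matrix.star_apply, Matrix.of_apply, hadamardEntry, Equiv.funUnique_symm_apply, uniqueElim_const]
    generalize s _ = a
    generalize t _ = b
    cases a <;> cases b <;> simp [h2] <;> norm_num

theorem apply_hadamard (q : Q) (ψ : (Q → Bool) → ℂ) (z : Q → Bool) :
    (hadamard q).apply ψ z = ∑ t, hadamardEntry (z q) t * ψ (Function.update z q t) := by
  change ∑ y : ({q} : Finset Q) → Bool,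
    hadamardEntry (z q) (y ⟨q, Finset.mem_singleton_self q⟩) *
      ψ (fun i => if h : i ∈ ({q} : Finset Q) then y ⟨i, h⟩ else z i) = _
  rw [← Equiv.sum_comp (Equiv.funUnique ({q} : Finset Q) Bool).symm]
  refine Finset.sum_congr rfl fun t _ => ?_
  congr 2
  funext i
  by_cases h : i = q
  · subst h; simp
  · simp [h]

/-- The diagonal gate multiplying the basis state `w` by `i ^ m` when `w a = w b = 1`. For `m = 2`
it is the controlled `Z` gate, for `m = 1` the controlled phase gate. -/
noncomputable def controlledPhase (a b : Q) (m : ℕ) : QuantumGate Q where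
  support := {a, b}
  op := Matrix.diagonal fun s =>
    Complex.I ^ (m * ((s ⟨a, by simp⟩).toNat * (s ⟨b, by simp⟩).toNat))
  unitary := by
    rw [Matrix.mem_unitaryGroup_iff, Matrix.star_eq_conjTranspose, Matrix.diagonal_conjTranspose,
      Matrix.diagonal_mul_diagonal, ← Matrix.diagonal_one]
    congr 1
    funext s
    simp [← mul_pow]

theorem apply_controlledPhase (a b : Q) (m : ℕ) (ψ : (Q → Bool) → ℂ) (z : Q → Bool) :
    (controlledPhase a b m).apply ψ z =
      Complex.I ^ (m * ((z a).toNat * (z b).toNat)) * ψ z := by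
  change ∑ y : ({a, b} : Finset Q) → Bool,
    (if (fun i : ({a, b} : Finset Q) => z i) = y then
      Complex.I ^ (m * ((z a).toNat * (z b).toNat)) else 0) *
      ψ (fun i => if h : i ∈ ({a, b} : Finset Q) then y ⟨i, h⟩ else z i) = _
  rw [Finset.sum_eq_single fun i : ({a, b} : Finset Q) => z i]
  · simp
  · intro y _ hy
    simp [hy.symm]
  · simp

theorem foldl_controlledPhase {V : Type} (l : List V) (a b : V → Q) (m : ℕ)
    (ψ : (Q → Bool) → ℂ) :
    (l.map fun p => controlledPhase (a p) (b p) m).foldl (fun ψ g => g.apply ψ) ψ =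
      fun z => (l.map fun p => Complex.I ^ (m * ((z (a p)).toNat * (z (b p)).toNat))).prod *
        ψ z := by
  induction l generalizing ψ with
  | nil => simp
  | cons p l ih =>
    funext z
    simp only [List.map_cons, List.foldl_cons, ih, apply_controlledPhase, List.prod_cons]
    ring

/-- A layer of Hadamard gates acts by the corresponding tensor power of the Hadamard matrix. -/
theorem foldl_hadamard [Fintype Q] (l : List Q) (hl : l.Nodup) (ψ : (Q → Bool) → ℂ) :
    (l.map hadamard).foldl (fun ψ g => g.apply ψ) ψ =
      fun z => ∑ a, (∏ q, if q ∈ l then hadamardEntry (z q) (a q)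
        else if z q = a q then 1 else 0) * ψ a := by
  induction l using List.reverseRecOn with
  | nil =>
    funext z
    simp [Finset.prod_ite_zero, ← funext_iff]
  | append_singleton l q ih =>
    funext z
    rw [List.nodup_append] at hl
    have hq : q ∉ l := fun h => (hl.2.2 q h q (by simp)) rfl
    rw [List.map_append, List.foldl_append, ih hl.1]
    simp only [List.map_cons, List.map_nil, List.foldl_cons, List.foldl_nil, apply_hadamard,
      Finset.mul_sum]
    rw [Finset.sum_comm]
    refine Finset.sum_congr rfl fun a _ => ?_
    -- As `q ∉ l`, the factor at `q` from the earlier gates is a Kronecker delta, which collapses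
    -- the sum over `t`; the other factors do not see the update.
    have herase : ∀ t, ∏ q' ∈ Finset.univ.erase q, (if q' ∈ l then
        hadamardEntry (Function.update z q t q') (a q')
        else if Function.update z q t q' = a q' then 1 else 0) =
        ∏ q' ∈ Finset.univ.erase q, if q' ∈ l ++ [q] then hadamardEntry (z q') (a q')
          else if z q' = a q' then (1 : ℂ) else 0 := by
      intro t
      refine Finset.prod_congr rfl fun q' hq' => ?_
      have := (Finset.mem_erase.1 hq').1
      simp [this]
    simp only [← Finset.mul_prod_erase _ _ (Finset.mem_univ q), herase]
    simp only [hq, Function.update_self, List.mem_append, List.mem_singleton, or_true, if_true,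
      if_false, Fintype.sum_bool]
    cases a q <;> simp <;> ring

end QuantumGate

/-! ### The torus game and the graph-state circuit. -/

namespace GridGame

/-- The vertices of the discrete torus of side `n + 1`. -/
abbrev Cell (n : ℕ) : Type := Fin (n + 1) × Fin (n + 1)

/-- The right neighbour of a vertex. -/
def right {n : ℕ} (q : Cell n) : Cell n := (q.1, q.2 + 1)

/-- The upper neighbour of a vertex. -/
def up {n : ℕ} (q : Cell n) : Cell n := (q.1 + 1, q.2)

theorem right_injective {n : ℕ} : Function.Injective (right (n := n)) := by
  rintro ⟨a, b⟩ ⟨c, d⟩ h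
  simpa [right] using h

theorem up_injective {n : ℕ} : Function.Injective (up (n := n)) := by
  rintro ⟨a, b⟩ ⟨c, d⟩ h
  simpa [up] using h

/-- The winning condition on a torus: on the input `x`, the labels `y` of the vertices and the
labels `h`, `v` of the horizontal and vertical edges are accepted if `h`, `v` is the coboundary of
a labelling `z` of the vertices and `|x| + 2 (x ⬝ z) + 2 |y|` is not congruent to `2` modulo `4`. -/
def Valid {n : ℕ} (x y h v : Cell n → Bool) : Prop :=
  ∃ z : Cell n → Bool, (∀ q, h q = (z q ^^ z (right q))) ∧ (∀ q, v q = (z q ^^ z (up q))) ∧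
    (∑ q, ((x q).toNat + 2 * (x q && z q).toNat + 2 * (y q).toNat)) % 4 ≠ 2

/-- The relation asking to win the game on each of the disjoint tori indexed by `ι`. The bijections
`eM` and `eN` enumerate the input bits, one for each vertex, and the output bits, one for each
vertex and for each edge. -/
def relation {ι : Type} {n M N : ℕ} (eM : ι × Cell n ≃ Fin M) (eN : (ι × Cell n) × Fin 3 ≃ Fin N) :
    Set (BitString M × BitString N) :=
  {p | ∀ b, Valid (fun q => p.1 (eM (b, q))) (fun q => p.2 (eN ((b, q), 0)))
    (fun q => p.2 (eN ((b, q), 1))) (fun q => p.2 (eN ((b, q), 2)))}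

open QuantumGate

/-- The input qubit of a vertex. -/
def inputQubit {V : Type} {M N : ℕ} (eM : V ≃ Fin M) (p : V) : Fin M ⊕ Fin N := Sum.inl (eM p)

/-- The ancilla of a vertex (`c = 0`), of a horizontal edge (`c = 1`) or of a vertical edge
(`c = 2`). -/
def ancilla {V : Type} {M N : ℕ} (eN : V × Fin 3 ≃ Fin N) (c : Fin 3) (p : V) : Fin M ⊕ Fin N :=
  Sum.inr (eN (p, c))

theorem ancilla_injective {V : Type} {M N : ℕ} (eN : V × Fin 3 ≃ Fin N) (c : Fin 3) :
    Function.Injective (ancilla (M := M) eN c) := by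
  intro p p' h
  simpa [ancilla] using h

section Circuit

variable {Q : Type} [DecidableEq Q] {V : Type} [Fintype V]

/-- A layer of controlled phase gates. -/
noncomputable def phaseLayer (a b : V → Q) (m : ℕ) : List (QuantumGate Q) :=
  (Finset.univ : Finset V).toList.map fun p => controlledPhase (a p) (b p) m

/-- A layer of Hadamard gates. -/
noncomputable def hadamardLayer (a : V → Q) : List (QuantumGate Q) :=
  ((Finset.univ : Finset V).toList.map a).map hadamard

/-- The pairs `(a p, b p)` form a matching. With `right` and `up` injective, the half-edges of the
subdivided torus split into four such matchings, whence the constant depth. -/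
theorem pairwise_phaseLayer {a b : V → Q} (m : ℕ) (ha : Function.Injective a)
    (hb : Function.Injective b) (hab : ∀ p p', a p ≠ b p') :
    (phaseLayer a b m).Pairwise fun g h => Disjoint g.support h.support := by
  refine List.Pairwise.map _ (fun p p' (h : p ≠ p') => ?_) (Finset.nodup_toList _)
  change Disjoint ({a p, b p} : Finset Q) {a p', b p'}
  simp [ha.eq_iff, hb.eq_iff, h.symm, hab, (hab _ _).symm]

theorem pairwise_hadamardLayer {a : V → Q} (ha : Function.Injective a) :
    (hadamardLayer a).Pairwise fun g h => Disjoint g.support h.support := by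
  refine List.Pairwise.map _ (fun p p' (h : p ≠ p') => ?_)
    ((Finset.nodup_toList _).map ha)
  change Disjoint ({p} : Finset Q) {p'}
  simpa using h

theorem card_support_phaseLayer (a b : V → Q) (m : ℕ) :
    ∀ g ∈ phaseLayer a b m, g.support.card ≤ 2 := by
  intro g hg
  obtain ⟨p, -, rfl⟩ := List.mem_map.1 hg
  exact Finset.card_le_two

theorem card_support_hadamardLayer (a : V → Q) :
    ∀ g ∈ hadamardLayer a, g.support.card ≤ 2 := by
  intro g hg
  obtain ⟨p, -, rfl⟩ := List.mem_map.1 hg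
  exact (Finset.card_singleton p).le.trans one_le_two

theorem foldl_phaseLayer (a b : V → Q) (m : ℕ) (ψ : (Q → Bool) → ℂ) :
    (phaseLayer a b m).foldl (fun ψ g => g.apply ψ) ψ =
      fun z => (∏ p, Complex.I ^ (m * ((z (a p)).toNat * (z (b p)).toNat))) * ψ z := by
  rw [phaseLayer, foldl_controlledPhase]
  simp only [Finset.prod_map_toList]

theorem foldl_hadamardLayer [Fintype Q] {a : V → Q} (ha : Function.Injective a)
    (ψ : (Q → Bool) → ℂ) :
    (hadamardLayer a).foldl (fun ψ g => g.apply ψ) ψ =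
      fun z => ∑ s, (∏ q, if q ∈ Set.range a then hadamardEntry (z q) (s q)
        else if z q = s q then 1 else 0) * ψ s := by
  classical
  rw [hadamardLayer, foldl_hadamard _ ((Finset.nodup_toList _).map ha)]
  simp

variable {M N : ℕ} (r u : V → V) (eM : V ≃ Fin M) (eN : V × Fin 3 ≃ Fin N)

/-- The layers of `GridGame.circuit`. -/
noncomputable def circuitLayers : List (List (QuantumGate (Fin M ⊕ Fin N))) :=
  [hadamardLayer Sum.inr,
    phaseLayer (ancilla eN 1) (ancilla eN 0) 2,
    phaseLayer (ancilla eN 1) (ancilla eN 0 ∘ r) 2,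
    phaseLayer (ancilla eN 2) (ancilla eN 0) 2,
    phaseLayer (ancilla eN 2) (ancilla eN 0 ∘ u) 2,
    -- A phase gate controlled by the input bit, followed by the Hadamard gate, changes an X
    -- measurement into a Y measurement.
    phaseLayer (inputQubit eM) (ancilla eN 0) 1,
    hadamardLayer Sum.inr]

/-- The circuit preparing the graph state of the graph obtained by subdividing the edges `p, r p`
and `p, u p`, and then measuring each vertex `p` in the basis `X` or `Y` prescribed by the input,
and the vertices added on the edges in the basis `X`. -/
noncomputable def circuit (hr : Function.Injective r) (hu : Function.Injective u) :
    QuantumCircuit M N where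
  ancillas := N
  layers := circuitLayers r u eM eN
  disjoint := by
    have hi := ancilla_injective (M := M) eN
    simp only [circuitLayers, List.forall_mem_cons]
    refine ⟨pairwise_hadamardLayer Sum.inr_injective,
      pairwise_phaseLayer _ (hi 1) (hi 0) ?_,
      pairwise_phaseLayer _ (hi 1) ((hi 0).comp hr) ?_,
      pairwise_phaseLayer _ (hi 2) (hi 0) ?_,
      pairwise_phaseLayer _ (hi 2) ((hi 0).comp hu) ?_,
      pairwise_phaseLayer _ (Sum.inl_injective.comp eM.injective) (hi 0) ?_,
      pairwise_hadamardLayer Sum.inr_injective, by simp⟩ <;>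
    simp [ancilla, inputQubit]
  output := ⟨Sum.inr, Sum.inr_injective⟩

/-- The contribution of the ancilla of a vertex, in the state `a`, to the amplitude of the
outcome `w`. -/
noncomputable def nodeFactor (x w a : Bool) : ℂ :=
  hadamardEntry w a * hadamardEntry a false * Complex.I ^ (1 * (x.toNat * a.toNat))

/-- The contribution of the ancilla of an edge, in the state `a`, to the amplitude of the outcome
`w`, when the endpoints are in the states `z` and `z'`. -/
noncomputable def edgeFactor (w a z z' : Bool) : ℂ :=
  hadamardEntry w a * hadamardEntry a false * Complex.I ^ (2 * (a.toNat * z.toNat)) *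
    Complex.I ^ (2 * (a.toNat * z'.toNat))

/-- The contribution of the vertex `p` to the amplitude, on the input `x`, of the outcome given by
`w₀` on the input qubits and by `w` on the ancillas, along the path through the basis state given
by `i` on the input qubits and by `a` on the ancillas. -/
noncomputable def amplitudeFactor (x w₀ : V → Bool) (w : Fin 3 → V → Bool) (i : V → Bool)
    (a : Fin 3 → V → Bool) (p : V) : ℂ :=
  (if w₀ p = i p then 1 else 0) * (if i p = x p then 1 else 0) *
    nodeFactor (x p) (w 0 p) (a 0 p) * edgeFactor (w 1 p) (a 1 p) (a 0 p) (a 0 (r p)) *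
    edgeFactor (w 2 p) (a 2 p) (a 0 p) (a 0 (u p))

/-- This relative phase is the source of the exponent in `Valid`. -/
theorem nodeFactor_not (x w a : Bool) : nodeFactor x w (!a) =
    nodeFactor x w a * Complex.I ^ (x.toNat + 2 * (x && a).toNat + 2 * w.toNat) := by
  have h3 : Complex.I ^ 3 = -Complex.I := Complex.I_pow_three
  have h4 : Complex.I ^ 4 = 1 := Complex.I_pow_four
  have h5 : Complex.I ^ 5 = Complex.I := by rw [pow_succ, h4, one_mul]
  cases x <;> cases w <;> cases a <;>
    simp [nodeFactor, hadamardEntry, mul_assoc, h3, h5]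

/-- Destructive interference of the two states of an edge ancilla: this forces the edge outcomes to
be the coboundary of the vertex states. -/
theorem edgeFactor_not (w a z z' : Bool) (h : w ≠ (z ^^ z')) :
    edgeFactor w (!a) z z' = -edgeFactor w a z z' := by
  revert h
  cases w <;> cases a <;> cases z <;> cases z' <;> simp [edgeFactor, hadamardEntry]

/-- An edge sees only `z ^^ z'`, so complementing all the vertex states of a torus is invisible to
it. -/
theorem edgeFactor_not_not (w a z z' : Bool) :
    edgeFactor w a (!z) (!z') = edgeFactor w a z z' := by
  cases w <;> cases a <;> cases z <;> cases z' <;> simp [edgeFactor, hadamardEntry]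

/-- A path sum: the middle layers are diagonal, so only the basis state `a` between the two Hadamard
layers is summed over, and the summand factors because each qubit and each gate is assigned to one
vertex. -/
theorem finalState_circuit (hr : Function.Injective r) (hu : Function.Injective u)
    (x : BitString M) (w : Fin M ⊕ Fin N → Bool) :
    (circuit r u eM eN hr hu).finalState x w = ∑ a : Fin M ⊕ Fin N → Bool, ∏ p,
      amplitudeFactor r u (fun p => x (eM p)) (fun p => w (inputQubit eM p))
        (fun c p => w (ancilla eN c p)) (fun p => a (inputQubit eM p))
        (fun c p => a (ancilla eN c p)) p := by
  have hprod : ∀ f : Fin M ⊕ Fin N → ℂ, ∏ q, f q =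
      ∏ p, (f (inputQubit eM p) * (f (ancilla eN 0 p) * f (ancilla eN 1 p) *
        f (ancilla eN 2 p))) := by
    intro f
    rw [Fintype.prod_sum_type, ← Equiv.prod_comp eM, ← Equiv.prod_comp eN, Fintype.prod_prod_type,
      ← Finset.prod_mul_distrib]
    simp only [Fin.prod_univ_three]
    rfl
  have hinit : (circuit r u eM eN hr hu).initialState x =
      fun s => if s = Sum.elim x fun _ => false then 1 else 0 := by
    funext s
    exact Pi.single_apply _ _ _
  have hlayers : (circuitLayers r u eM eN).flatten = hadamardLayer Sum.inr ++
      (phaseLayer (ancilla eN 1) (ancilla eN 0) 2 ++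
      (phaseLayer (ancilla eN 1) (ancilla eN 0 ∘ r) 2 ++
      (phaseLayer (ancilla eN 2) (ancilla eN 0) 2 ++
      (phaseLayer (ancilla eN 2) (ancilla eN 0 ∘ u) 2 ++
      (phaseLayer (inputQubit eM) (ancilla eN 0) 1 ++ hadamardLayer Sum.inr))))) := by
    simp only [circuitLayers, List.flatten_cons, List.flatten_nil, List.append_nil]
  unfold QuantumCircuit.finalState
  rw [hinit]
  change List.foldl (fun ψ (g : QuantumGate (Fin M ⊕ Fin N)) => g.apply ψ)
    (fun s => if s = Sum.elim x fun _ => false then 1 else 0)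
    (circuitLayers r u eM eN).flatten w = _
  rw [hlayers]
  simp only [List.foldl_append]
  rw [foldl_hadamardLayer Sum.inr_injective, foldl_hadamardLayer Sum.inr_injective]
  simp only [foldl_phaseLayer, mul_ite, mul_one, mul_zero, Finset.sum_ite_eq',
    Finset.mem_univ, if_true]
  refine Finset.sum_congr rfl fun a _ => ?_
  rw [hprod, hprod]
  simp only [← Finset.prod_mul_distrib]
  refine Finset.prod_congr rfl fun p _ => ?_
  by_cases h1 : w (Sum.inl (eM p)) = a (Sum.inl (eM p))
  · by_cases h2 : a (Sum.inl (eM p)) = x (eM p)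
    · simp [amplitudeFactor, nodeFactor, edgeFactor, inputQubit, ancilla, h1, h2]
      ring
    · simp [amplitudeFactor, inputQubit, h2]
  · simp [amplitudeFactor, inputQubit, h1]

theorem prod_amplitudeFactor_edge [DecidableEq V] (x w₀ : V → Bool) (w : Fin 3 → V → Bool) (i : V → Bool)
    (a a' : Fin 3 → V → Bool) (c : Fin 3) (p : V) (hc : c = 1 ∧ w 1 p ≠ (a 0 p ^^ a 0 (r p)) ∨
      c = 2 ∧ w 2 p ≠ (a 0 p ^^ a 0 (u p)))
    (ha : ∀ c' p', a' c' p' = (a c' p' ^^ decide (c' = c ∧ p' = p))) :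
    ∏ p, amplitudeFactor r u x w₀ w i a' p = -∏ p, amplitudeFactor r u x w₀ w i a p := by
  rw [← Finset.mul_prod_erase _ _ (Finset.mem_univ p),
    ← Finset.mul_prod_erase _ (amplitudeFactor r u x w₀ w i a) (Finset.mem_univ p), ← neg_mul]
  congr 1
  · rcases hc with ⟨rfl, h⟩ | ⟨rfl, h⟩ <;> simp [amplitudeFactor, ha, edgeFactor_not _ _ _ _ h]
  · refine Finset.prod_congr rfl fun p' hp' => ?_
    have := (Finset.mem_erase.1 hp').1
    rcases hc with ⟨rfl, -⟩ | ⟨rfl, -⟩ <;> simp [amplitudeFactor, ha, this]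

end Circuit

/-- Complementing the vertex states of one torus keeps its edge factors and multiplies its node
factors by a total phase `I ^ e` with `e % 4 = 2`, that is, by -1. -/
theorem prod_amplitudeFactor_nodes {ι : Type} [Fintype ι] [DecidableEq ι] {n : ℕ}
    (x w₀ : ι × Cell n → Bool) (w : Fin 3 → ι × Cell n → Bool) (i : ι × Cell n → Bool)
    (a a' : Fin 3 → ι × Cell n → Bool) (b : ι)
    (hb : (∑ q, ((x (b, q)).toNat + 2 * (x (b, q) && a 0 (b, q)).toNat +
      2 * (w 0 (b, q)).toNat)) % 4 = 2)
    (ha : ∀ c p, a' c p = (a c p ^^ decide (c = 0 ∧ p.1 = b))) :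
    ∏ p, amplitudeFactor (Prod.map id right) (Prod.map id up) x w₀ w i a' p =
      -∏ p, amplitudeFactor (Prod.map id right) (Prod.map id up) x w₀ w i a p := by
  rw [Fintype.prod_prod_type, Fintype.prod_prod_type,
    ← Finset.mul_prod_erase _ _ (Finset.mem_univ b),
    ← Finset.mul_prod_erase _ (fun b => ∏ q, amplitudeFactor _ _ x w₀ w i a (b, q))
      (Finset.mem_univ b), ← neg_mul]
  congr 1
  · have h : ∀ q, amplitudeFactor (Prod.map id right) (Prod.map id up) x w₀ w i a' (b, q) =
        amplitudeFactor (Prod.map id right) (Prod.map id up) x w₀ w i a (b, q) *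
          Complex.I ^ ((x (b, q)).toNat + 2 * (x (b, q) && a 0 (b, q)).toNat +
            2 * (w 0 (b, q)).toNat) := by
      intro q
      simp [amplitudeFactor, ha, edgeFactor_not_not, nodeFactor_not]
      split_ifs <;> ring
    have hI : ∀ e : ℕ, e % 4 = 2 → Complex.I ^ e = -1 := by
      intro e he
      rw [← Nat.div_add_mod e 4, he, pow_add, pow_mul, Complex.I_pow_four, one_pow, one_mul,
        Complex.I_sq]
    simp only [h]
    rw [Finset.prod_mul_distrib, Finset.prod_pow_eq_pow_sum, hI _ hb]
    ring
  · refine Finset.prod_congr rfl fun b' hb' => Finset.prod_congr rfl fun q _ => ?_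
    have := (Finset.mem_erase.1 hb').1
    simp [amplitudeFactor, ha, this]

/-! ### The quantum circuit wins with certainty. -/

section Completeness

variable {ι : Type} [Fintype ι] {n M N : ℕ} (eM : ι × Cell n ≃ Fin M)
  (eN : (ι × Cell n) × Fin 3 ≃ Fin N)

/-- The circuit of constant depth that wins the game on each of the tori indexed by `ι`. -/
noncomputable def torusCircuit : QuantumCircuit M N :=
  circuit (Prod.map id right) (Prod.map id up) eM eN
    (Function.injective_id.prodMap right_injective) (Function.injective_id.prodMap up_injective)

/-- A sign-reversing involution on the paths, acting on a torus `b` that is lost: flip the ancilla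
of an edge whose outcome disagrees with the vertex states, if there is one, and otherwise all the
vertex ancillas. -/
theorem finalState_eq_zero (x : BitString M) (w : Fin M ⊕ Fin N → Bool)
    (hw : (x, fun j => w (Sum.inr j)) ∉ relation eM eN) :
    (torusCircuit eM eN).finalState x w = 0 := by
  classical
  obtain ⟨b, hb⟩ := not_forall.1 hw
  refine (finalState_circuit _ _ eM eN _ _ x w).trans ?_
  let z : (Fin M ⊕ Fin N → Bool) → Cell n → Bool := fun a q => a (ancilla eN 0 (b, q))
  let Bad : (Cell n → Bool) → Fin 3 × Cell n → Prop := fun z e =>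
    e.1 = 1 ∧ w (ancilla eN 1 (b, e.2)) ≠ (z e.2 ^^ z (right e.2)) ∨
      e.1 = 2 ∧ w (ancilla eN 2 (b, e.2)) ≠ (z e.2 ^^ z (up e.2))
  -- The flip is chosen from `z a` alone. An edge flip fixes `z a` and a vertex flip complements it,
  -- which leaves `Bad` unchanged, so applying `σ` again undoes the same flip.
  let mask : (Cell n → Bool) → Fin M ⊕ Fin N → Bool := fun z s =>
    if H : ∃ e, Bad z e then decide (s = ancilla eN H.choose.1 (b, H.choose.2))
    else decide (∃ q, s = ancilla eN 0 (b, q))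
  let σ : (Fin M ⊕ Fin N → Bool) → Fin M ⊕ Fin N → Bool := fun a s => a s ^^ mask (z a) s
  have hinput : ∀ a p, σ a (inputQubit eM p) = a (inputQubit eM p) := by
    intro a p
    by_cases H : ∃ e, Bad (z a) e <;> simp [σ, mask, inputQubit, ancilla]
  have hedge : ∀ a (H : ∃ e, Bad (z a) e) c p, σ a (ancilla eN c p) = (a (ancilla eN c p) ^^
      decide (c = H.choose.1 ∧ p = (b, H.choose.2))) := by
    intro a H c p
    change (a _ ^^ mask (z a) _) = _
    rw [show mask (z a) (ancilla eN c p) = decide ((ancilla eN c p : Fin M ⊕ Fin N) =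
      ancilla eN H.choose.1 (b, H.choose.2)) from dif_pos H]
    generalize H.choose = e
    simp [ancilla, and_comm]
  have hnode : ∀ a, (¬ ∃ e, Bad (z a) e) → ∀ c p, σ a (ancilla eN c p) = (a (ancilla eN c p) ^^
      decide (c = 0 ∧ p.1 = b)) := by
    rintro a H c ⟨b', q⟩
    change (a _ ^^ mask (z a) _) = _
    rw [show mask (z a) (ancilla eN c (b', q)) = decide (∃ q', (ancilla eN c (b', q) :
      Fin M ⊕ Fin N) = ancilla eN 0 (b, q')) from dif_neg H]
    congr 2
    simp only [ancilla, Sum.inr.injEq, EmbeddingLike.apply_eq_iff_eq, Prod.mk.injEq]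
    grind
  have hmask : ∀ a, mask (z (σ a)) = mask (z a) := by
    intro a
    by_cases H : ∃ e, Bad (z a) e
    · have : z (σ a) = z a := by
        funext q
        have h0 : (0 : Fin 3) ≠ H.choose.1 := by
          rcases H.choose_spec with h | h <;> rw [h.1] <;> decide
        simp [z, hedge a H, h0]
      rw [this]
    · have h1 : z (σ a) = fun q => !(z a q) := by
        funext q
        simp [z, hnode a H]
      have h2 : ¬ ∃ e, Bad (z (σ a)) e := by
        rw [h1]
        simpa [Bad] using H
      funext s
      simp only [mask, H, h2, dif_neg, not_false_eq_true]
  have hinv : Function.Involutive σ := by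
    intro a
    funext s
    change (a s ^^ mask (z a) s ^^ mask (z (σ a)) s) = a s
    rw [hmask, Bool.xor_assoc, Bool.xor_self, Bool.xor_false]
  have hneg := Equiv.sum_comp hinv.toPerm fun a => ∏ p,
    amplitudeFactor (Prod.map id right) (Prod.map id up) (fun p => x (eM p))
      (fun p => w (inputQubit eM p)) (fun c p => w (ancilla eN c p))
      (fun p => a (inputQubit eM p)) (fun c p => a (ancilla eN c p)) p
  rw [Finset.sum_congr rfl (g := fun a => -∏ p,
    amplitudeFactor (Prod.map id right) (Prod.map id up) (fun p => x (eM p))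
      (fun p => w (inputQubit eM p)) (fun c p => w (ancilla eN c p))
      (fun p => a (inputQubit eM p)) (fun c p => a (ancilla eN c p)) p), Finset.sum_neg_distrib]
    at hneg
  · exact self_eq_neg.1 hneg.symm
  · intro a _
    simp only [Function.Involutive.coe_toPerm, hinput]
    by_cases H : ∃ e, Bad (z a) e
    · exact prod_amplitudeFactor_edge _ _ _ _ _ _ _ _ _ _ H.choose_spec (hedge a H)
    · refine prod_amplitudeFactor_nodes _ _ _ _ _ _ b ?_ (hnode a H)
      -- Without a bad edge, `z a` is a potential for the edge labels, so losing can only come from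
      -- the condition modulo 4.
      by_contra hne
      refine hb ⟨z a, fun q => ?_, fun q => ?_, hne⟩
      · by_contra h
        exact H ⟨(1, q), Or.inl ⟨rfl, h⟩⟩
      · by_contra h
        exact H ⟨(2, q), Or.inr ⟨rfl, h⟩⟩

theorem outputProb_torusCircuit (x : BitString M) :
    (torusCircuit eM eN).outputProb x (validOutputs (relation eM eN) x) = 1 := by
  have h : (torusCircuit eM eN).outputProb x (validOutputs (relation eM eN) x) =
      ∑ w, ‖(torusCircuit eM eN).finalState x w‖ ^ 2 := by
    refine Finset.sum_congr rfl fun w _ => ?_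
    split_ifs with hw
    · rfl
    · rw [finalState_eq_zero eM eN x w hw]
      simp
  rw [h, QuantumCircuit.finalState, sum_norm_sq_foldl, QuantumCircuit.initialState,
    Finset.sum_eq_single (Sum.elim x fun _ => false)]
  · simp
  · intro w _ hw
    simp [hw]
  · simp

theorem faninAtMost_torusCircuit : (torusCircuit eM eN).FaninAtMost 2 := by
  change ∀ L ∈ circuitLayers (Prod.map id right) (Prod.map id up) eM eN, ∀ g ∈ L, _
  simp only [circuitLayers, List.forall_mem_cons]
  refine ⟨card_support_hadamardLayer _, card_support_phaseLayer _ _ _,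
    card_support_phaseLayer _ _ _, card_support_phaseLayer _ _ _, card_support_phaseLayer _ _ _,
    card_support_phaseLayer _ _ _, card_support_hadamardLayer _, by simp⟩

theorem depth_torusCircuit : (torusCircuit eM eN).depth = 7 := rfl

end Completeness

/-! ### The classical obstruction on one torus. -/

theorem eq_of_forall_eq_add_one {n : ℕ} {α : Type*} {τ : Fin (n + 1) → α}
    (h : ∀ j, τ j = τ (j + 1)) (j j' : Fin (n + 1)) : τ j = τ j' := by
  have key : ∀ j, τ j = τ 0 := by
    intro j
    induction j using Fin.induction with
    | zero => rfl
    | succ i ih => rw [← ih, h i.castSucc, Fin.coeSucc_eq_succ]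
  rw [key j, key j']

/-- The input `x` with the bits at `u`, `v`, `w` changed when `a`, `b`, `c` respectively is true. -/
def toggle {n : ℕ} (u v w : Cell n) (a b c : Bool) (x : Cell n → Bool) : Cell n → Bool :=
  fun q => x q ^^ (decide (q = u) && a) ^^ (decide (q = v) && b) ^^ (decide (q = w) && c)

theorem toggle_toggle {n : ℕ} (u v w : Cell n) (a b c a' b' c' : Bool) (x : Cell n → Bool) :
    toggle u v w a b c (toggle u v w a' b' c' x) =
      toggle u v w (a ^^ a') (b ^^ b') (c ^^ c') x := by
  funext q
  simp only [toggle]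
  cases x q <;> cases decide (q = u) <;> cases decide (q = v) <;> cases decide (q = w) <;>
    simp <;> cases a <;> cases b <;> cases c <;> simp

/-- When the labels of the cell `q` depend only on the inputs in the sets `D q c`, the inputs at
`a` and `b` influence no common label, and the input at `b` influences no horizontal edge in the
row of `a` and no vertical edge in the column of `a`. -/
def Separated {n : ℕ} (D : Cell n → Fin 3 → Finset (Cell n)) (a b : Cell n) : Prop :=
  a ≠ b ∧ (∀ q c, a ∈ D q c → b ∉ D q c) ∧ (∀ q, q.1 = a.1 → b ∉ D q 1) ∧
    ∀ q, q.2 = a.2 → b ∉ D q 2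

/-- For a vertex whose bit is the same in all four inputs: `4 x` and the labels `y` vanish modulo 4,
leaving `2 x` times the sum of the potentials, of which only the parity `κ` matters. -/
theorem bool_sum_same (x z₀ z₁ z₂ z₃ y₀ y₁ y₂ y₃ κ : Bool) (hz : (z₀ ^^ z₁ ^^ z₂ ^^ z₃) = κ)
    (hy : (y₀ ^^ y₁ ^^ y₂ ^^ y₃) = false) :
    ((x.toNat + 2 * (x && z₀).toNat + 2 * y₀.toNat : ℕ) : ZMod 4) +
      (x.toNat + 2 * (x && z₁).toNat + 2 * y₁.toNat : ℕ) +
      (x.toNat + 2 * (x && z₂).toNat + 2 * y₂.toNat : ℕ) +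
      (x.toNat + 2 * (x && z₃).toNat + 2 * y₃.toNat : ℕ) = 2 * (κ.toNat : ZMod 4) * x.toNat := by
  subst hz
  revert hy
  cases x <;> cases y₀ <;> cases y₁ <;> cases y₂ <;> cases y₃ <;> simp <;>
  cases z₀ <;> cases z₁ <;> cases z₂ <;> cases z₃ <;> decide

/-- For a vertex toggled in the two middle inputs: the potentials that are read are `z₁, z₂` if `x`
is false and `z₀, z₃` if it is true, and `κ` converts the second pair into the first. The extra 2
drives the contradiction. -/
theorem bool_sum_not (x z₀ z₁ z₂ z₃ y₀ y₁ y₂ y₃ κ : Bool) (hz : (z₀ ^^ z₁ ^^ z₂ ^^ z₃) = κ)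
    (hy : (y₀ ^^ y₁ ^^ y₂ ^^ y₃) = false) :
    ((x.toNat + 2 * (x && z₀).toNat + 2 * y₀.toNat : ℕ) : ZMod 4) +
      ((!x).toNat + 2 * (!x && z₁).toNat + 2 * y₁.toNat : ℕ) +
      ((!x).toNat + 2 * (!x && z₂).toNat + 2 * y₂.toNat : ℕ) +
      (x.toNat + 2 * (x && z₃).toNat + 2 * y₃.toNat : ℕ) =
      2 * (κ.toNat : ZMod 4) * x.toNat + (2 + 2 * (z₁.toNat + z₂.toNat)) := by
  subst hz
  revert hy
  cases x <;> cases y₀ <;> cases y₁ <;> cases y₂ <;> cases y₃ <;> simp <;>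
  cases z₀ <;> cases z₁ <;> cases z₂ <;> cases z₃ <;> decide

theorem two_mul_add_eq_of_xor_eq (a b c d : Bool) (h : (a ^^ b) = (c ^^ d)) :
    2 * ((a.toNat : ZMod 4) + b.toNat) = 2 * (c.toNat + d.toNat) := by
  revert a b c d
  decide

theorem sum_toggle {n : ℕ} (u v w : Cell n) (a b c : Bool) (x : Cell n → Bool) :
    ((∑ q, (toggle u v w a b c x q).toNat : ℕ) : ZMod 2) =
      ((∑ q, (x q).toNat : ℕ) : ZMod 2) + a.toNat + b.toNat + c.toNat := by
  have hq : ∀ q, ((toggle u v w a b c x q).toNat : ZMod 2) = (x q).toNat +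
      (if q = u then (a.toNat : ZMod 2) else 0) + (if q = v then (b.toNat : ZMod 2) else 0) +
      (if q = w then (c.toNat : ZMod 2) else 0) := by
    intro q
    have key : ∀ x a b c : Bool, ((x ^^ a ^^ b ^^ c).toNat : ZMod 2) =
      x.toNat + a.toNat + b.toNat + c.toNat := by decide
    have ite : ∀ (P : Prop) [Decidable P] (a : Bool),
        ((decide P && a).toNat : ZMod 2) = if P then (a.toNat : ZMod 2) else 0 := by
      intro P _ a
      split_ifs with h <;> simp [h]
    rw [toggle, key, ite, ite, ite]
  push_cast
  simp only [hq, Finset.sum_add_distrib, Finset.sum_ite_eq', Finset.mem_univ, if_true]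

section Local

variable {n : ℕ} {D : Cell n → Fin 3 → Finset (Cell n)}
  {f : (Cell n → Bool) → Cell n → Fin 3 → Bool}

theorem exists_toggle_not_valid_of_even
    (hf : ∀ q c x x', (∀ p ∈ D q c, x p = x' p) → f x q c = f x' q c) {u v w : Cell n}
    (huv : Separated D u v) (hvu : Separated D v u) (huw : Separated D u w)
    (hwu : Separated D w u) (hvw : Separated D v w) (hwv : Separated D w v) (x : Cell n → Bool)
    (hx : ((∑ q, (x q).toNat : ℕ) : ZMod 2) = 0) :
    ∃ a b c, ¬ Valid (toggle u v w a b c x) (fun q => f (toggle u v w a b c x) q 0)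
      (fun q => f (toggle u v w a b c x) q 1) (fun q => f (toggle u v w a b c x) q 2) := by
  by_contra! H
  choose z hh hv hphase using H
  have dep_u : ∀ {q c}, u ∉ D q c → ∀ a a' b b',
      f (toggle u v w a b b' x) q c = f (toggle u v w a' b b' x) q c := by
    intro q c h a a' b b'
    refine hf _ _ _ _ fun p hp => ?_
    have : p ≠ u := fun h' => h (h' ▸ hp)
    simp [toggle, this]
  have dep_v : ∀ {q c}, v ∉ D q c → ∀ a b b' a',
      f (toggle u v w a b a' x) q c = f (toggle u v w a b' a' x) q c := by
    intro q c h a b b' a'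
    refine hf _ _ _ _ fun p hp => ?_
    have : p ≠ v := fun h' => h (h' ▸ hp)
    simp [toggle, this]
  have dep_w : ∀ {q c}, w ∉ D q c → ∀ a b c' c'',
      f (toggle u v w a b c' x) q c = f (toggle u v w a b c'' x) q c := by
    intro q c h a b c' c''
    refine hf _ _ _ _ fun p hp => ?_
    have : p ≠ w := fun h' => h (h' ▸ hp)
    simp [toggle, this]
  -- Each of the three bits is toggled in exactly two of these four inputs, and a label sees at most
  -- one of the bits, so its four values cancel in pairs.
  have four : ∀ q c, (f (toggle u v w false false false x) q c ^^
      f (toggle u v w true true false x) q c ^^ f (toggle u v w true false true x) q c ^^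
      f (toggle u v w false true true x) q c) = false := by
    intro q c
    have alternate : ∀ a b : Bool, (a ^^ b ^^ a ^^ b) = false := by decide
    by_cases hu : u ∈ D q c
    · have h1 := huv.2.1 q c hu
      have h2 := huw.2.1 q c hu
      rw [dep_v h1 false false true false, dep_w h2 false true false true,
        dep_v h1 true true false false, dep_w h2 true false false true]
      simp
    · by_cases hv : v ∈ D q c
      · have h2 := hvw.2.1 q c hv
        rw [dep_u hu false true false false, dep_w h2 true false false true,
          dep_u hu false true true true, dep_w h2 true true true false]
        exact alternate _ _
      · rw [dep_u hu false true false false, dep_v hv true false true false,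
          dep_u hu false true true true, dep_v hv true true false true]
        simp
  -- Go along the row of `a` to the column of `b`, then along that column; the last two clauses of
  -- `Separated` are made for such paths.
  have walk : ∀ τ : Cell n → Bool, ∀ a b : Cell n, (∀ q, q.1 = a.1 → τ q = τ (right q)) →
      (∀ q, q.2 = b.2 → τ q = τ (up q)) → τ a = τ b := by
    rintro τ ⟨a₁, a₂⟩ ⟨b₁, b₂⟩ h1 h2
    exact (eq_of_forall_eq_add_one (τ := fun j => τ (a₁, j)) (fun j => h1 (a₁, j) rfl) a₂ b₂).trans
      (eq_of_forall_eq_add_one (τ := fun j => τ (j, b₂)) (fun j => h2 (j, b₂) rfl) a₁ b₁)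
  have swap : ∀ {a b c d e e' : Bool}, e = (a ^^ b) → e' = (c ^^ d) → e = e' →
      (a ^^ c) = (b ^^ d) := by decide
  have swap' : ∀ {a b c d : Bool}, (a ^^ c) = (b ^^ d) → (a ^^ b) = (c ^^ d) := by decide
  -- The labels on the path from `u` to `v` do not see `w`, so its bit may be set. The three paths
  -- are thereby all compared with the one potential `z true true true`.
  have path_uv : (z true true false u ^^ z true true false v) =
      (z true true true u ^^ z true true true v) := swap' <|
    walk (fun q => z true true false q ^^ z true true true q) u v
      (fun q hq => swap (hh _ _ _ q) (hh _ _ _ q) (dep_w (huw.2.2.1 q hq) _ _ _ _))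
      (fun q hq => swap (hv _ _ _ q) (hv _ _ _ q) (dep_w (hvw.2.2.2 q hq) _ _ _ _))
  have path_uw : (z true false true u ^^ z true false true w) =
      (z true true true u ^^ z true true true w) := swap' <|
    walk (fun q => z true false true q ^^ z true true true q) u w
      (fun q hq => swap (hh _ _ _ q) (hh _ _ _ q) (dep_v (huv.2.2.1 q hq) _ _ _ _))
      (fun q hq => swap (hv _ _ _ q) (hv _ _ _ q) (dep_v (hwv.2.2.2 q hq) _ _ _ _))
  have path_vw : (z false true true v ^^ z false true true w) =
      (z true true true v ^^ z true true true w) := swap' <|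
    walk (fun q => z false true true q ^^ z true true true q) v w
      (fun q hq => swap (hh _ _ _ q) (hh _ _ _ q) (dep_u (hvu.2.2.1 q hq) _ _ _ _))
      (fun q hq => swap (hv _ _ _ q) (hv _ _ _ q) (dep_u (hwu.2.2.2 q hq) _ _ _ _))
  have swap4 : ∀ {a b c d a' b' c' d' e₁ e₂ e₃ e₄ : Bool}, e₁ = (a ^^ a') → e₂ = (b ^^ b') →
      e₃ = (c ^^ c') → e₄ = (d ^^ d') → (e₁ ^^ e₂ ^^ e₃ ^^ e₄) = false →
      (a ^^ b ^^ c ^^ d) = (a' ^^ b' ^^ c' ^^ d') := by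
    rintro a b c d a' b' c' d' _ _ _ _ rfl rfl rfl rfl
    revert a b c d a' b' c' d'
    decide
  -- The sum of the four potentials has zero coboundary, hence is constant on the torus.
  obtain ⟨κ, hκ⟩ : ∃ κ, ∀ q, (z false false false q ^^ z true true false q ^^ z true false true q ^^
      z false true true q) = κ :=
    ⟨_, fun q => walk (fun q => z false false false q ^^ z true true false q ^^
      z true false true q ^^ z false true true q) q u
      (fun q _ => swap4 (hh _ _ _ q) (hh _ _ _ q) (hh _ _ _ q) (hh _ _ _ q) (four q 1))
      (fun q _ => swap4 (hv _ _ _ q) (hv _ _ _ q) (hv _ _ _ q) (hv _ _ _ q) (four q 2))⟩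
  -- Even weight makes the exponent even, and an even number that is not 2 modulo 4 is 0.
  have phase : ∀ a b c : Bool, ((a.toNat : ZMod 2) + b.toNat + c.toNat = 0) →
      ∑ q, ((((toggle u v w a b c x q).toNat + 2 * (toggle u v w a b c x q && z a b c q).toNat +
        2 * (f (toggle u v w a b c x) q 0).toNat : ℕ)) : ZMod 4) = 0 := by
    intro a b c habc
    rw [← Nat.cast_sum, ZMod.natCast_eq_zero_iff]
    have h1 := hphase a b c
    beta_reduce at h1
    have h2 : 2 ∣ ∑ q, ((toggle u v w a b c x q).toNat +
        2 * (toggle u v w a b c x q && z a b c q).toNat +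
        2 * (f (toggle u v w a b c x) q 0).toNat) := by
      rw [← ZMod.natCast_eq_zero_iff, Finset.sum_add_distrib, Finset.sum_add_distrib,
        ← Finset.mul_sum, ← Finset.mul_sum, Nat.cast_add, Nat.cast_add, sum_toggle, hx]
      push_cast
      rw [show (2 : ZMod 2) = 0 from rfl]
      linear_combination habc
    omega
  have total := congrArg₂ (· + ·) (congrArg₂ (· + ·) (congrArg₂ (· + ·)
    (phase false false false (by decide)) (phase true true false (by decide)))
    (phase true false true (by decide))) (phase false true true (by decide))
  simp only [← Finset.sum_add_distrib, add_zero] at total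
  have cell : ∀ q, ((((toggle u v w false false false x q).toNat +
        2 * (toggle u v w false false false x q && z false false false q).toNat +
        2 * (f (toggle u v w false false false x) q 0).toNat : ℕ)) : ZMod 4) +
      (((toggle u v w true true false x q).toNat +
        2 * (toggle u v w true true false x q && z true true false q).toNat +
        2 * (f (toggle u v w true true false x) q 0).toNat : ℕ)) +
      (((toggle u v w true false true x q).toNat +
        2 * (toggle u v w true false true x q && z true false true q).toNat +
        2 * (f (toggle u v w true false true x) q 0).toNat : ℕ)) +
      (((toggle u v w false true true x q).toNat +
        2 * (toggle u v w false true true x q && z false true true q).toNat +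
        2 * (f (toggle u v w false true true x) q 0).toNat : ℕ)) =
      2 * (κ.toNat : ZMod 4) * (x q).toNat +
      (if q = u then 2 + 2 * (((z true true false u).toNat : ZMod 4) +
        (z true false true u).toNat) else 0) +
      (if q = v then 2 + 2 * (((z true true false v).toNat : ZMod 4) +
        (z false true true v).toNat) else 0) +
      (if q = w then 2 + 2 * (((z true false true w).toNat : ZMod 4) +
        (z false true true w).toNat) else 0) := by
    intro q
    have hy := four q 0
    have hz := hκ q
    generalize f (toggle u v w false false false x) q 0 = y₀ at *
    generalize f (toggle u v w true true false x) q 0 = y₁ at *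
    generalize f (toggle u v w true false true x) q 0 = y₂ at *
    generalize f (toggle u v w false true true x) q 0 = y₃ at *
    -- These permutations bring the two inputs that toggle `v`, respectively `w`, to the middle
    -- places, as `bool_sum_not` requires.
    have swap₁ : ∀ a b c d : Bool, (a ^^ b ^^ d ^^ c) = (a ^^ b ^^ c ^^ d) := by decide
    have swap₂ : ∀ a b c d : Bool, (a ^^ c ^^ d ^^ b) = (a ^^ b ^^ c ^^ d) := by decide
    by_cases hqu : q = u
    · subst hqu
      have := bool_sum_not (x q) _ _ _ _ _ _ _ _ κ hz hy
      simpa [toggle, huv.1, huw.1] using this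
    · by_cases hqv : q = v
      · subst hqv
        have := bool_sum_not (x q) (z false false false q) (z true true false q)
          (z false true true q) (z true false true q) y₀ y₁ y₃ y₂ κ ((swap₁ _ _ _ _).trans hz) ((swap₁ _ _ _ _).trans hy)
        rw [add_right_comm] at this
        simp [toggle, hqu, hvw.1] at this ⊢
        linear_combination this
      · by_cases hqw : q = w
        · subst hqw
          have := bool_sum_not (x q) (z false false false q) (z true false true q)
            (z false true true q) (z true true false q) y₀ y₂ y₃ y₁ κ
            ((swap₂ _ _ _ _).trans hz) ((swap₂ _ _ _ _).trans hy)
          simp [toggle, hqu, hqv] at this ⊢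
          linear_combination this
        · have := bool_sum_same (x q) _ _ _ _ _ _ _ _ κ hz hy
          simpa [toggle, hqu, hqv, hqw] using this
  simp only [cell, Finset.sum_add_distrib, Finset.sum_ite_eq', Finset.mem_univ, if_true,
    ← Finset.mul_sum] at total
  have h4 : (4 : ZMod 4) = 0 := rfl
  have hx4 : (2 : ZMod 4) * ∑ q, ((x q).toNat : ZMod 4) = 0 := by
    obtain ⟨t, ht⟩ := (ZMod.natCast_eq_zero_iff _ 2).1 hx
    rw [← Nat.cast_sum, ht]
    push_cast
    linear_combination (t : ZMod 4) * h4
  have e1 := two_mul_add_eq_of_xor_eq _ _ _ _ path_uv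
  have e2 := two_mul_add_eq_of_xor_eq _ _ _ _ path_uw
  have e3 := two_mul_add_eq_of_xor_eq _ _ _ _ path_vw
  -- The three toggled vertices give 6 = 2; each value of `z true true true` occurs twice with
  -- coefficient 2, and the `κ` term vanishes because `x` has even weight.
  have : (2 : ZMod 4) = 0 := by
    linear_combination total - e1 - e2 - e3 - (κ.toNat : ZMod 4) * hx4 -
      (1 + ((z true true true u).toNat : ZMod 4) + (z true true true v).toNat +
        (z true true true w).toNat) * h4
  exact absurd this (by decide)

/-- An input of odd weight becomes even after toggling `u`, and stays in the same orbit. -/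
theorem exists_toggle_not_valid
    (hf : ∀ q c x x', (∀ p ∈ D q c, x p = x' p) → f x q c = f x' q c) {u v w : Cell n}
    (huv : Separated D u v) (hvu : Separated D v u) (huw : Separated D u w)
    (hwu : Separated D w u) (hvw : Separated D v w) (hwv : Separated D w v) (x : Cell n → Bool) :
    ∃ a b c, ¬ Valid (toggle u v w a b c x) (fun q => f (toggle u v w a b c x) q 0)
      (fun q => f (toggle u v w a b c x) q 1) (fun q => f (toggle u v w a b c x) q 2) := by
  have h01 : ∀ t : ZMod 2, t = 0 ∨ t + 1 = 0 := by decide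
  rcases h01 ((∑ q, (x q).toNat : ℕ) : ZMod 2) with h | h
  · exact exists_toggle_not_valid_of_even hf huv hvu huw hwu hvw hwv x h
  · obtain ⟨a, b, c, habc⟩ := exists_toggle_not_valid_of_even hf huv hvu huw hwu hvw hwv
      (toggle u v w true false false x) (by rw [sum_toggle]; simpa using h)
    rw [toggle_toggle] at habc
    exact ⟨_, _, _, habc⟩

end Local

end GridGame

/-! ### Light cones of classical circuits. -/

theorem BooleanCircuit.exists_gateValue_dependsOn {I : Type} [DecidableEq I] {N : ℕ}
    (C : BooleanCircuit I N) {k : ℕ} (hk : 1 ≤ k) (hC : ∀ g, C.fanin g ≤ k) (g : Fin C.size) :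
    ∃ T : Finset I, T.card ≤ k ^ C.gateDepth g ∧
      ∀ x x' : I → Bool, (∀ i ∈ T, x i = x' i) → C.gateValue x g = C.gateValue x' g := by
  obtain ⟨m, hm⟩ : ∃ m, (g : ℕ) = m := ⟨_, rfl⟩
  induction m using Nat.strong_induction_on generalizing g with
  | _ m ih =>
  subst hm
  let argDepth : Fin (C.fanin g) → ℕ := fun j =>
    match C.arg g j with
    | Sum.inl _ => 0
    | Sum.inr h => C.gateDepth ⟨h, h.isLt.trans g.isLt⟩
  have harg : ∀ j : Fin (C.fanin g), ∃ T : Finset I, T.card ≤ k ^ argDepth j ∧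
      ∀ x x' : I → Bool, (∀ i ∈ T, x i = x' i) →
        (match C.arg g j with
          | Sum.inl i => x i
          | Sum.inr h => C.gateValue x ⟨h, h.isLt.trans g.isLt⟩) =
        (match C.arg g j with
          | Sum.inl i => x' i
          | Sum.inr h => C.gateValue x' ⟨h, h.isLt.trans g.isLt⟩) := by
    intro j
    simp only [argDepth]
    cases C.arg g j with
    | inl i => exact ⟨{i}, by simp, fun x x' h => h i (by simp)⟩
    | inr h => exact ih h h.isLt ⟨h, h.isLt.trans g.isLt⟩ rfl
  choose T hT hx using harg
  refine ⟨Finset.univ.biUnion T, ?_, fun x x' h => ?_⟩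
  · rw [BooleanCircuit.gateDepth]
    calc (Finset.univ.biUnion T).card ≤ ∑ j, (T j).card := Finset.card_biUnion_le
      _ ≤ ∑ _j : Fin (C.fanin g), k ^ Finset.univ.sup argDepth :=
        Finset.sum_le_sum fun j _ => (hT j).trans
          (Nat.pow_le_pow_right hk (Finset.le_sup (Finset.mem_univ j)))
      _ ≤ k ^ (1 + Finset.univ.sup argDepth) := by
        rw [Finset.sum_const, Finset.card_univ, Fintype.card_fin, smul_eq_mul, pow_add, pow_one]
        exact Nat.mul_le_mul_right _ (hC g)
  · rw [BooleanCircuit.gateValue, BooleanCircuit.gateValue]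
    congr 1
    funext j
    exact hx j x x' fun i hi => h i (Finset.mem_biUnion.2 ⟨j, Finset.mem_univ j, hi⟩)

/-- Each output bit of a circuit depends on at most `k ^ depth` input bits. -/
theorem BooleanCircuit.exists_eval_dependsOn {I : Type} [DecidableEq I] {N : ℕ}
    (C : BooleanCircuit I N) {k : ℕ} (hk : 1 ≤ k) (hC : ∀ g, C.fanin g ≤ k) (j : Fin N) :
    ∃ T : Finset I, T.card ≤ k ^ C.depth ∧
      ∀ x x' : I → Bool, (∀ i ∈ T, x i = x' i) → C.eval x j = C.eval x' j := by
  have hle : Sum.elim (fun _ => 0) C.gateDepth (C.output j) ≤ C.depth :=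
    Finset.le_sup (f := fun j => Sum.elim (fun _ => 0) C.gateDepth (C.output j))
      (Finset.mem_univ j)
  simp only [BooleanCircuit.eval]
  cases h : C.output j with
  | inl i => exact ⟨{i}, by simpa using Nat.one_le_pow _ _ hk, fun x x' h => h i (by simp)⟩
  | inr g =>
    obtain ⟨T, hT, hx⟩ := C.exists_gateValue_dependsOn hk hC g
    rw [h] at hle
    exact ⟨T, hT.trans (Nat.pow_le_pow_right hk hle), hx⟩

/-! ### Counting separated triples, and the direct product over many tori. -/

namespace GridGame

/-- Otherwise each of the |α|^3 triples has a related pair in one of six ordered positions, and each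
position accounts for |r| |α| triples. Distinctness is not needed here: it is part of `Separated`.
-/
theorem exists_triple_of_card_lt {α : Type*} [Fintype α] (r : α → α → Prop)
    [DecidableRel r] (h : 6 * (Finset.univ.filter fun p : α × α => r p.1 p.2).card <
      Fintype.card α ^ 2) :
    ∃ u v w, ¬ r u v ∧ ¬ r v u ∧ ¬ r u w ∧ ¬ r w u ∧ ¬ r v w ∧ ¬ r w v := by
  by_contra! H
  let g : α → α → ℕ := fun u v => if r u v then 1 else 0
  have hg : ∑ u, ∑ v, g u v = (Finset.univ.filter fun p : α × α => r p.1 p.2).card := by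
    rw [Finset.card_filter, Fintype.sum_prod_type]
  have hg' : ∑ u, ∑ v, g v u = (Finset.univ.filter fun p : α × α => r p.1 p.2).card := by
    rw [Finset.sum_comm, hg]
  have h1 : ∀ u v w, 1 ≤ g u v + g v u + g u w + g w u + g v w + g w v := by
    intro u v w
    have := H u v w
    simp only [g]
    grind
  have h2 : ∑ _u : α, ∑ _v : α, ∑ _w : α, 1 ≤
      ∑ u, ∑ v, ∑ w, (g u v + g v u + g u w + g w u + g v w + g w v) :=
    Finset.sum_le_sum fun u _ => Finset.sum_le_sum fun v _ => Finset.sum_le_sum fun w _ => h1 u v w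
  simp only [Finset.sum_add_distrib, Finset.sum_const, Finset.card_univ, smul_eq_mul,
    ← Finset.mul_sum, hg, hg', mul_one] at h2
  nlinarith [Nat.zero_le (Fintype.card α)]

/-- One term per way to fail: equality; a common label, with 3 labels per cell and `ℓ ^ 2` pairs
each; and, for each edge label, the `n + 1` vertices of its row or column against the `ℓ` inputs it
sees. -/
theorem card_not_separated_le {n ℓ : ℕ} (D : Cell n → Fin 3 → Finset (Cell n))
    (hD : ∀ q c, (D q c).card ≤ ℓ) [DecidableRel fun a b => ¬ Separated D a b] :
    (Finset.univ.filter fun p : Cell n × Cell n => ¬ Separated D p.1 p.2).card ≤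
      (n + 1) ^ 2 * (1 + 3 * ℓ ^ 2 + 2 * (n + 1) * ℓ) := by
  have hsub : (Finset.univ.filter fun p : Cell n × Cell n => ¬ Separated D p.1 p.2) ⊆
      (Finset.univ.image fun q : Cell n => (q, q)) ∪
      (Finset.univ.biUnion fun q : Cell n => Finset.univ.biUnion fun c => D q c ×ˢ D q c) ∪
      (Finset.univ.biUnion fun q : Cell n => ({q.1} ×ˢ Finset.univ) ×ˢ D q 1) ∪
      (Finset.univ.biUnion fun q : Cell n => (Finset.univ ×ˢ {q.2}) ×ˢ D q 2) := by
    rintro ⟨a, b⟩ h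
    simp only [Finset.mem_filter, Finset.mem_univ, true_and] at h
    simp only [Finset.mem_union, Finset.mem_image, Finset.mem_biUnion, Finset.mem_univ, true_and,
      Finset.mem_product, Finset.mem_singleton, Prod.mk.injEq, and_true]
    by_contra! hn
    obtain ⟨⟨⟨h1, h2⟩, h3⟩, h4⟩ := hn
    exact h ⟨fun hab => h1 a rfl hab, h2, fun q hq => h3 q hq.symm, fun q hq => h4 q hq.symm⟩
  have hcell : (Finset.univ : Finset (Cell n)).card = (n + 1) ^ 2 := by
    simp [Fintype.card_prod, sq]
  have h1 : (Finset.univ.image fun q : Cell n => (q, q)).card ≤ (n + 1) ^ 2 :=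
    Finset.card_image_le.trans hcell.le
  have h2 : (Finset.univ.biUnion fun q : Cell n =>
      Finset.univ.biUnion fun c => D q c ×ˢ D q c).card ≤ (n + 1) ^ 2 * (3 * ℓ ^ 2) := by
    rw [← hcell]
    refine Finset.card_biUnion_le_card_mul _ _ _ fun q _ => ?_
    refine (Finset.card_biUnion_le_card_mul _ _ (ℓ ^ 2) fun c _ => ?_).trans_eq (by simp)
    rw [Finset.card_product, sq]
    exact Nat.mul_le_mul (hD q c) (hD q c)
  have h3 : (Finset.univ.biUnion fun q : Cell n =>
      (({q.1} : Finset (Fin (n + 1))) ×ˢ (Finset.univ : Finset (Fin (n + 1)))) ×ˢ D q 1).card ≤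
      (n + 1) ^ 2 * ((n + 1) * ℓ) := by
    rw [← hcell]
    refine Finset.card_biUnion_le_card_mul _ _ _ fun q _ => ?_
    rw [Finset.card_product, Finset.card_product]
    simpa using hD q 1
  have h4 : (Finset.univ.biUnion fun q : Cell n =>
      ((Finset.univ : Finset (Fin (n + 1))) ×ˢ ({q.2} : Finset (Fin (n + 1)))) ×ˢ D q 2).card ≤
      (n + 1) ^ 2 * ((n + 1) * ℓ) := by
    rw [← hcell]
    refine Finset.card_biUnion_le_card_mul _ _ _ fun q _ => ?_
    rw [Finset.card_product, Finset.card_product]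
    simpa using hD q 2
  refine (Finset.card_le_card hsub).trans ?_
  refine (Finset.card_union_le _ _).trans ?_
  refine (Nat.add_le_add_right (Finset.card_union_le _ _) _).trans ?_
  refine (Nat.add_le_add_right (Nat.add_le_add_right (Finset.card_union_le _ _) _) _).trans ?_
  refine (Nat.add_le_add (Nat.add_le_add (Nat.add_le_add h1 h2) h3) h4).trans_eq ?_
  ring

theorem exists_separated {n ℓ : ℕ} (D : Cell n → Fin 3 → Finset (Cell n))
    (hD : ∀ q c, (D q c).card ≤ ℓ) (hℓ : 6 * (1 + 3 * ℓ ^ 2 + 2 * (n + 1) * ℓ) < (n + 1) ^ 2) :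
    ∃ u v w, Separated D u v ∧ Separated D v u ∧ Separated D u w ∧ Separated D w u ∧
      Separated D v w ∧ Separated D w v := by
  classical
  obtain ⟨u, v, w, h⟩ := exists_triple_of_card_lt (fun a b => ¬ Separated D a b) (by
    have h1 := card_not_separated_le D hD
    have h2 : Fintype.card (Cell n) = (n + 1) ^ 2 := by simp [Fintype.card_prod, sq]
    rw [h2]
    nlinarith [Nat.pos_of_ne_zero (pow_ne_zero 2 (Nat.succ_ne_zero n))])
  simp only [not_not] at h
  exact ⟨u, v, w, h⟩

/-- Greedy choice: in-degrees within `T` average at most `Δ`, so some `v` has at most `Δ`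
in-neighbours in `T`. Keep `v`, discard its neighbours in both directions, and recurse. -/
theorem exists_independent_subset {ι : Type*} [DecidableEq ι] (out : ι → Finset ι) {Δ : ℕ}
    (hout : ∀ b, (out b).card ≤ Δ) (T : Finset ι) :
    ∃ S ⊆ T, T.card ≤ S.card * (2 * Δ + 1) ∧ ∀ b ∈ S, ∀ b' ∈ S, b ≠ b' → b' ∉ out b := by
  induction T using Finset.strongInduction with
  | _ T ih =>
  rcases T.eq_empty_or_nonempty with rfl | hne
  · exact ⟨∅, by simp⟩
  obtain ⟨v, hv, hvin⟩ : ∃ v ∈ T, (T.filter fun b => v ∈ out b).card ≤ Δ := by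
    refine Finset.exists_le_of_sum_le hne ?_
    have h1 := Finset.sum_card_bipartiteAbove_eq_sum_card_bipartiteBelow (s := T) (t := T)
      fun b v => v ∈ out b
    simp only [Finset.bipartiteAbove, Finset.bipartiteBelow] at h1
    rw [← h1]
    exact Finset.sum_le_sum fun b _ => (Finset.card_le_card fun v hv =>
      (Finset.mem_filter.1 hv).2).trans (hout b)
  let X := {v} ∪ out v ∪ T.filter fun b => v ∈ out b
  have hX : X.card ≤ 2 * Δ + 1 := by
    have h1 := Finset.card_union_le ({v} ∪ out v) (T.filter fun b => v ∈ out b)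
    have h2 := Finset.card_union_le {v} (out v)
    have h3 := hout v
    simp only [Finset.card_singleton] at h2
    simp only [X]
    omega
  obtain ⟨S, hST, hcard, hS⟩ := ih (T \ X) (Finset.ssubset_iff_subset_ne.2
    ⟨Finset.sdiff_subset, fun h => (Finset.mem_sdiff.1 (h.symm ▸ hv : v ∈ T \ X)).2 (by simp [X])⟩)
  have hSX : ∀ b ∈ S, b ∈ T ∧ b ∉ X := fun b hb => Finset.mem_sdiff.1 (hST hb)
  have hvS : v ∉ S := fun h => (hSX v h).2 (by simp [X])
  refine ⟨insert v S, ?_, ?_, ?_⟩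
  · exact Finset.insert_subset hv fun b hb => (hSX b hb).1
  · rw [Finset.card_insert_of_notMem hvS]
    have := Finset.card_le_card_sdiff_add_card (s := T) (t := X)
    nlinarith
  · intro b hb b' hb' hbb'
    rcases Finset.mem_insert.1 hb with rfl | hbS <;> rcases Finset.mem_insert.1 hb' with rfl | hbS'
    · exact absurd rfl hbb'
    · exact fun h => (hSX b' hbS').2 (by simp [X, h])
    · exact fun h => (hSX b hbS).2 (by simp [X, h, (hSX b hbS).1])
    · exact hS b hbS b' hbS' hbb'

/-- Double counting of the pairs `(s, x)` with `P (Θ s x)`: each `Θ s` permutes `A`, and each `x`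
misses some `s`. -/
theorem card_mul_card_filter_le {X κ : Type*} [Fintype κ] (A : Finset X)
    (P : X → Prop) [DecidablePred P] (Θ : κ → X → X) (hΘ : ∀ s, Function.Involutive (Θ s))
    (hA : ∀ s, ∀ x ∈ A, Θ s x ∈ A) (hP : ∀ x, ∃ s, ¬ P (Θ s x)) :
    Fintype.card κ * (A.filter P).card ≤ (Fintype.card κ - 1) * A.card := by
  have h1 : ∀ s, (A.filter fun x => P (Θ s x)).card = (A.filter P).card := fun s =>
    Finset.card_nbij' (Θ s) (Θ s) (fun x hx => by
        have := Finset.mem_filter.1 hx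
        exact Finset.mem_filter.2 ⟨hA s x this.1, this.2⟩)
      (fun x hx => by
        have := Finset.mem_filter.1 hx
        exact Finset.mem_filter.2 ⟨hA s x this.1, by rw [hΘ s x]; exact this.2⟩)
      (fun x _ => hΘ s x) (fun x _ => hΘ s x)
  have h2 : ∑ s, (A.filter fun x => P (Θ s x)).card =
      ∑ x ∈ A, (Finset.univ.filter fun s => P (Θ s x)).card :=
    Finset.sum_card_bipartiteAbove_eq_sum_card_bipartiteBelow (s := Finset.univ) (t := A)
      fun s x => P (Θ s x)
  simp only [h1, Finset.sum_const, Finset.card_univ, smul_eq_mul] at h2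
  rw [h2, mul_comm, ← smul_eq_mul]
  refine Finset.sum_le_card_nsmul _ _ _ fun x _ => ?_
  obtain ⟨s, hs⟩ := hP x
  have : (Finset.univ.filter fun s => P (Θ s x)).card < Fintype.card κ := by
    rw [← Finset.card_univ]
    exact Finset.card_lt_card (Finset.filter_ssubset.2 ⟨s, Finset.mem_univ s, hs⟩)
  omega

/-- A direct product bound: if every event `P b` fails at a point of each orbit of the involutions
`Φ b s` of the coordinate `b`, and depends on no other coordinate in `S`, then the events `P b` for
`b ∈ S` hold simultaneously with probability at most `(1 - 1 / |κ|) ^ |S|`. -/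
theorem card_pow_mul_card_forall_le {ι Y κ : Type*} [Fintype ι] [DecidableEq ι] [Fintype Y]
    [Fintype κ] (P : ι → (ι → Y) → Prop) [∀ b, DecidablePred (P b)] (S : Finset ι)
    (Φ : ι → κ → Y → Y) (hΦ : ∀ b s, Function.Involutive (Φ b s))
    (hP : ∀ b ∈ S, ∀ x, ∃ s, ¬ P b (Function.update x b (Φ b s (x b))))
    (hS : ∀ b ∈ S, ∀ b' ∈ S, b ≠ b' → ∀ x y, P b x → P b (Function.update x b' y)) :
    Fintype.card κ ^ S.card * (Finset.univ.filter fun x => ∀ b ∈ S, P b x).card ≤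
      (Fintype.card κ - 1) ^ S.card * Fintype.card (ι → Y) := by
  induction S using Finset.induction_on with
  | empty => simp [Finset.card_univ]
  | insert b S hb ih =>
    have ih' := ih (fun b' hb' => hP b' (Finset.mem_insert_of_mem hb'))
      fun b₁ h₁ b₂ h₂ => hS b₁ (Finset.mem_insert_of_mem h₁) b₂ (Finset.mem_insert_of_mem h₂)
    -- The events already treated ignore the coordinate `b`, so their intersection is stable under
    -- the involutions at `b`.
    have hstep := card_mul_card_filter_le (Finset.univ.filter fun x => ∀ b ∈ S, P b x) (P b)
      (fun s x => Function.update x b (Φ b s (x b)))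
      (fun s x => by simp [hΦ b s (x b)])
      (fun s x hx => by
        simp only [Finset.mem_filter, Finset.mem_univ, true_and] at hx ⊢
        exact fun b' hb' => hS b' (Finset.mem_insert_of_mem hb') b (Finset.mem_insert_self b S)
          (fun h => hb (h ▸ hb')) _ _ (hx b' hb'))
      (hP b (Finset.mem_insert_self b S))
    have heq : (Finset.univ.filter fun x => ∀ b' ∈ insert b S, P b' x) =
        (Finset.univ.filter fun x => ∀ b ∈ S, P b x).filter (P b) := by
      ext x
      simp [and_comm]
    rw [Finset.card_insert_of_notMem hb, heq, pow_succ, pow_succ, mul_assoc]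
    calc _ ≤ Fintype.card κ ^ S.card * ((Fintype.card κ - 1) *
          (Finset.univ.filter fun x => ∀ b ∈ S, P b x).card) := Nat.mul_le_mul_left _ hstep
      _ = (Fintype.card κ - 1) * (Fintype.card κ ^ S.card *
          (Finset.univ.filter fun x => ∀ b ∈ S, P b x).card) := by ring
      _ ≤ (Fintype.card κ - 1) * ((Fintype.card κ - 1) ^ S.card * Fintype.card (ι → Y)) :=
        Nat.mul_le_mul_left _ ih'
      _ = _ := by ring

open Classical in
/-- Functions all of whose output bits depend on few input bits win all the games simultaneously
on a fraction of the inputs that is exponentially small in the number of games. -/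
theorem exists_card_valid_le {ι : Type} [Fintype ι] {n ℓ : ℕ}
    (hℓ : 6 * (1 + 3 * ℓ ^ 2 + 2 * (n + 1) * ℓ) < (n + 1) ^ 2)
    (F : (ι → Cell n → Bool) → ι × Cell n → Fin 3 → Bool)
    (E : ι × Cell n → Fin 3 → Finset (ι × Cell n)) (hE : ∀ p c, (E p c).card ≤ ℓ)
    (hF : ∀ p c x x', (∀ p' ∈ E p c, x p'.1 p'.2 = x' p'.1 p'.2) → F x p c = F x' p c) :
    ∃ s, Fintype.card ι ≤ s * (2 * ((n + 1) ^ 2 * (3 * ℓ)) + 1) ∧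
      8 ^ s * (Finset.univ.filter fun x : ι → Cell n → Bool => ∀ b, Valid (x b)
        (fun q => F x (b, q) 0) (fun q => F x (b, q) 1) (fun q => F x (b, q) 2)).card ≤
      7 ^ s * Fintype.card (ι → Cell n → Bool) := by
  let out : ι → Finset ι := fun b =>
    Finset.univ.biUnion fun q : Cell n => Finset.univ.biUnion fun c => (E (b, q) c).image Prod.fst
  have hout : ∀ b, (out b).card ≤ (n + 1) ^ 2 * (3 * ℓ) := by
    intro b
    refine (Finset.card_biUnion_le_card_mul _ _ (3 * ℓ) fun q _ => ?_).trans_eq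
      (by simp [Fintype.card_prod, sq])
    refine (Finset.card_biUnion_le_card_mul _ _ ℓ fun c _ => ?_).trans_eq (by simp)
    exact Finset.card_image_le.trans (hE _ _)
  obtain ⟨S, -, hScard, hS⟩ := exists_independent_subset out hout Finset.univ
  let D : ι → Cell n → Fin 3 → Finset (Cell n) := fun b q c => (E (b, q) c).image Prod.snd
  have hD : ∀ b q c, (D b q c).card ≤ ℓ := fun b q c => Finset.card_image_le.trans (hE _ _)
  choose u v w huv hvu huw hwu hvw hwv using fun b => exists_separated (D b) (hD b) hℓ
  refine ⟨S.card, by simpa [Finset.card_univ] using hScard, ?_⟩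
  have hprod := card_pow_mul_card_forall_le
    (P := fun b (x : ι → Cell n → Bool) => Valid (x b) (fun q => F x (b, q) 0)
      (fun q => F x (b, q) 1) (fun q => F x (b, q) 2)) S
    (κ := Bool × Bool × Bool)
    (fun b s => toggle (u b) (v b) (w b) s.1 s.2.1 s.2.2) (fun b s x => by
      rw [toggle_toggle]
      funext q
      simp [toggle]) (fun b _ x => by
      -- With the inputs of the other tori frozen, the answers on torus `b` form a local strategy
      -- for a single game.
      obtain ⟨a, a', a'', h⟩ := exists_toggle_not_valid (D := D b)
        (f := fun x' q c => F (Function.update x b x') (b, q) c) (fun q c x₁ x₂ h => by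
          refine hF _ _ _ _ ?_
          rintro ⟨b', q'⟩ hp
          by_cases hb : b' = b
          · subst hb
            simpa using h q' (Finset.mem_image.2 ⟨_, hp, rfl⟩)
          · simp [hb])
        (huv b) (hvu b) (huw b) (hwu b) (hvw b) (hwv b) (x b)
      exact ⟨(a, a', a''), by simpa using h⟩)
    (fun b hb b' hb' hbb' x y h => by
      have hx : ∀ q c, F (Function.update x b' y) (b, q) c = F x (b, q) c := by
        intro q c
        refine hF _ _ _ _ fun p hp => ?_
        have : p.1 ≠ b' := by
          rintro rfl
          refine hS b hb p.1 hb' hbb' ?_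
          exact Finset.mem_biUnion.2 ⟨q, Finset.mem_univ _, Finset.mem_biUnion.2
            ⟨c, Finset.mem_univ _, Finset.mem_image.2 ⟨p, hp, rfl⟩⟩⟩
        simp [this]
      simpa only [hx, Function.update_of_ne hbb'] using h)
  have h8 : Fintype.card (Bool × Bool × Bool) = 8 := rfl
  rw [h8] at hprod
  refine (Nat.mul_le_mul_left _ (Finset.card_le_card fun x hx => ?_)).trans hprod
  simp only [Finset.mem_filter, Finset.mem_univ, true_and] at hx ⊢
  exact fun b _ => hx b

open Classical in
/-- A circuit with small light cones wins all the games simultaneously on few inputs. -/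
theorem exists_card_eval_mem_le {ι : Type} [Fintype ι] {n M N m k : ℕ} (eM : ι × Cell n ≃ Fin M)
    (eN : (ι × Cell n) × Fin 3 ≃ Fin N) (C : BooleanCircuit (Fin M ⊕ Fin m) N) (hk : 1 ≤ k)
    (hC : ∀ g, C.fanin g ≤ k)
    (hℓ : 6 * (1 + 3 * (k ^ C.depth) ^ 2 + 2 * (n + 1) * k ^ C.depth) < (n + 1) ^ 2)
    (r : BitString m) :
    ∃ s, Fintype.card ι ≤ s * (2 * ((n + 1) ^ 2 * (3 * k ^ C.depth)) + 1) ∧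
      8 ^ s * (Finset.univ.filter fun x : BitString M =>
        C.eval (Sum.elim x r) ∈ validOutputs (relation eM eN) x).card ≤ 7 ^ s * 2 ^ M := by
  let e : (ι → Cell n → Bool) ≃ BitString M :=
    (Equiv.curry ι (Cell n) Bool).symm.trans (Equiv.arrowCongr eM (Equiv.refl Bool))
  have he : ∀ x b q, e x (eM (b, q)) = x b q := by
    intro x b q
    simp [e, Function.uncurry]
  choose T hT hx using C.exists_eval_dependsOn hk hC
  obtain ⟨s, hs, hcard⟩ := exists_card_valid_le hℓ
    (fun x p c => C.eval (Sum.elim (e x) r) (eN (p, c)))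
    -- The string `r` is fixed, so the random wires of the light cone can be dropped.
    (fun p c => Finset.univ.filter fun p' => Sum.inl (eM p') ∈ T (eN (p, c)))
    (fun p c => (Finset.card_le_card_of_injOn (fun p' => Sum.inl (eM p'))
      (fun p' hp' => (Finset.mem_filter.1 hp').2)
      (fun p' _ p'' _ h => eM.injective (Sum.inl_injective h))).trans (hT _))
    (fun p c x x' h => hx _ _ _ fun i hi => by
      rcases i with j | j
      · obtain ⟨⟨b, q⟩, rfl⟩ := eM.surjective j
        simpa [he] using h (b, q) (Finset.mem_filter.2 ⟨Finset.mem_univ _, hi⟩)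
      · rfl)
  refine ⟨s, hs, ?_⟩
  have hX : Fintype.card (ι → Cell n → Bool) = 2 ^ M := by
    rw [Fintype.card_congr e]
    simp
  rw [hX] at hcard
  refine le_of_eq_of_le ?_ hcard
  congr 1
  refine (Finset.card_equiv e fun x => ?_).symm
  have : C.eval (Sum.elim (e x) r) ∈ validOutputs (relation eM eN) (e x) ↔ ∀ b,
      Valid (fun q => e x (eM (b, q))) (fun q => C.eval (Sum.elim (e x) r) (eN ((b, q), 0)))
        (fun q => C.eval (Sum.elim (e x) r) (eN ((b, q), 1)))
        (fun q => C.eval (Sum.elim (e x) r) (eN ((b, q), 2))) := Iff.rfl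
  rw [Finset.mem_filter, Finset.mem_filter, this]
  simp only [he, Finset.mem_univ]

end GridGame

/-! ### Averaging over the randomness and the final estimates. -/

/-- The average success probability is an average, over the random string, of the success
probabilities of deterministic circuits. -/
theorem RandomizedCircuit.averageSuccess_le {M N : ℕ} (C : RandomizedCircuit M N)
    (R : Set (BitString M × BitString N)) (ε : ℝ) [∀ r, DecidablePred fun x : BitString M =>
      C.circuit.eval (Sum.elim x r) ∈ validOutputs R x]
    (h : ∀ r, ((Finset.univ.filter fun x : BitString M =>
      C.circuit.eval (Sum.elim x r) ∈ validOutputs R x).card : ℝ) ≤ ε * 2 ^ M) :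
    C.averageSuccess R ≤ ε := by
  have hsum : ∑ r, (C.dist r).toReal = 1 := by
    have h1 := C.dist.tsum_coe
    rw [tsum_fintype] at h1
    rw [← ENNReal.toReal_sum fun r _ => C.dist.apply_ne_top r, h1, ENNReal.toReal_one]
  have hswap : ∑ x, C.outputProb x (validOutputs R x) = ∑ r, (C.dist r).toReal *
      ((Finset.univ.filter fun x : BitString M =>
        C.circuit.eval (Sum.elim x r) ∈ validOutputs R x).card : ℝ) := by
    simp only [RandomizedCircuit.outputProb]
    rw [Finset.sum_comm]
    refine Finset.sum_congr rfl fun r _ => ?_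
    rw [Finset.card_filter, Nat.cast_sum, Finset.mul_sum]
    refine Finset.sum_congr rfl fun x _ => ?_
    split_ifs <;> simp
  rw [RandomizedCircuit.averageSuccess, hswap, one_div, inv_mul_le_iff₀ (by positivity)]
  calc _ ≤ ∑ r, (C.dist r).toReal * (ε * 2 ^ M) :=
        Finset.sum_le_sum fun r _ => mul_le_mul_of_nonneg_left (h r) ENNReal.toReal_nonneg
    _ = 2 ^ M * ε := by rw [← Finset.sum_mul, hsum]; ring

namespace GridGame

theorem seven_eighths_pow_lt {L s : ℕ} (hL : 3 ≤ L) (hs : L ^ 9 ≤ s) :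
    (7 / 8 : ℝ) ^ s ≤ Real.exp (-(L : ℝ) ^ 9 / 8) ∧
      Real.exp (-(L : ℝ) ^ 9 / 8) < 1 / Real.exp ((L : ℝ) ^ 7) := by
  constructor
  · have h1 : (7 / 8 : ℝ) ≤ Real.exp (-1 / 8) := by
      have := Real.add_one_le_exp (-1 / 8 : ℝ)
      linarith
    calc (7 / 8 : ℝ) ^ s ≤ (7 / 8 : ℝ) ^ (L ^ 9) :=
          pow_le_pow_of_le_one (by norm_num) (by norm_num) hs
      _ ≤ Real.exp (-1 / 8) ^ (L ^ 9) := pow_le_pow_left₀ (by norm_num) h1 _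
      _ = Real.exp (-(L : ℝ) ^ 9 / 8) := by
        rw [← Real.exp_nat_mul]
        congr 1
        push_cast
        ring
  · rw [one_div, ← Real.exp_neg, Real.exp_lt_exp]
    have hL' : (3 : ℝ) ≤ L := by exact_mod_cast hL
    have h7 : (0 : ℝ) < (L : ℝ) ^ 7 := by positivity
    nlinarith [mul_lt_mul_of_pos_left (show (8 : ℝ) < (L : ℝ) ^ 2 by nlinarith) h7]

/-- The depth lower bound for `L ^ 12` games on tori of side `L`. -/
theorem le_depth_of_averageSuccess_ge {L k : ℕ} (hk : 2 ≤ k) (hL : 400 ≤ L) {n M N : ℕ}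
    (hn : n + 1 = L) (hM : M = L ^ 14)
    (eM : Fin (L ^ 12) × Cell n ≃ Fin M) (eN : (Fin (L ^ 12) × Cell n) × Fin 3 ≃ Fin N)
    (C : RandomizedCircuit M N) (hC : C.FaninAtMost k)
    (h : 1 / Real.exp (1 * Real.sqrt M) ≤ C.averageSuccess (relation eM eN)) :
    1 / (28 * Real.log k) * Real.log M ≤ C.depth := by
  classical
  by_contra! hdepth
  have hlogk : 0 < Real.log k := Real.log_pos (by exact_mod_cast hk)
  have hL0 : (0 : ℝ) < L := by exact_mod_cast (by omega : 0 < L)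
  have hM' : (M : ℝ) = (L : ℝ) ^ 14 := by rw [hM, Nat.cast_pow]
  -- Here log M = 14 log L, and 28 = 2 · 14 yields the square.
  have hcone : (k ^ C.circuit.depth) ^ 2 ≤ L := by
    have h1 : (k : ℝ) ^ (2 * C.depth) ≤ L := by
      rw [← Real.log_le_log_iff (by positivity) hL0, Real.log_pow]
      rw [hM', Real.log_pow, div_mul_eq_mul_div, lt_div_iff₀ (by positivity)] at hdepth
      push_cast at hdepth ⊢
      linarith
    rw [← pow_mul, mul_comm]
    exact_mod_cast h1
  set ℓ := k ^ C.circuit.depth with hℓ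
  -- From ℓ ≤ √L and √L ≥ 20.
  have h20 : 20 * ℓ ≤ L := by
    by_contra! hlt
    nlinarith
  have hsmall : 6 * (1 + 3 * ℓ ^ 2 + 2 * (n + 1) * ℓ) < (n + 1) ^ 2 := by
    rw [hn]
    nlinarith
  have hsqrt : Real.sqrt M = (L : ℝ) ^ 7 := by
    rw [hM', show (L : ℝ) ^ 14 = ((L : ℝ) ^ 7) ^ 2 by ring,
      Real.sqrt_sq (by positivity)]
  have hle : C.averageSuccess (relation eM eN) ≤ Real.exp (-(L : ℝ) ^ 9 / 8) := by
    refine C.averageSuccess_le _ _ fun r => ?_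
    obtain ⟨s, hs, hcard⟩ := exists_card_eval_mem_le eM eN C.circuit (by omega) hC hsmall r
    rw [Fintype.card_fin, hn] at hs
    -- The greedy choice loses a factor of at most `L ^ 3` out of `L ^ 12` tori.
    have hs9 : L ^ 9 ≤ s := by
      have h3 : 2 * (L ^ 2 * (3 * ℓ)) + 1 ≤ L ^ 3 := by
        have : L ^ 2 * (20 * ℓ) ≤ L ^ 2 * L := Nat.mul_le_mul_left _ h20
        have h1 : 1 ≤ L ^ 2 := Nat.one_le_pow _ _ (by omega)
        nlinarith
      have h4 : L ^ 9 * L ^ 3 ≤ s * L ^ 3 := by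
        rw [← pow_add]
        exact hs.trans (Nat.mul_le_mul_left _ h3)
      exact Nat.le_of_mul_le_mul_right h4 (Nat.pow_pos (by omega))
    have hcard' : (8 : ℝ) ^ s * ((Finset.univ.filter fun x : BitString M =>
        C.circuit.eval (Sum.elim x r) ∈ validOutputs (relation eM eN) x).card : ℝ) ≤
        7 ^ s * 2 ^ M := by
      convert (Nat.cast_le (α := ℝ)).2 hcard using 1 <;> push_cast <;> rfl
    refine le_trans ?_ (mul_le_mul_of_nonneg_right
      (seven_eighths_pow_lt (by omega) hs9).1 (by positivity))
    rw [div_pow, div_mul_eq_mul_div, le_div_iff₀ (by positivity)]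
    linarith
  have hlt := (seven_eighths_pow_lt (L := L) (by omega) le_rfl).2
  rw [one_mul, hsqrt] at h
  linarith

end GridGame

theorem theorem1 :
    ∃ (M N : ℕ → ℕ) (R : ∀ i : ℕ, Set (BitString (M i) × BitString (N i))),
      StrictMono M ∧
      (∃ K D : ℕ, ∀ i : ℕ, ∃ Q : QuantumCircuit (M i) (N i),
        Q.FaninAtMost K ∧ Q.depth ≤ D ∧
        ∀ x : BitString (M i), Q.outputProb x (validOutputs (R i) x) = 1) ∧
      (∃ γ : ℝ, 0 < γ ∧ ∀ k : ℕ, ∃ c : ℝ, 0 < c ∧ ∀ᶠ i in atTop,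
        ∀ C : RandomizedCircuit (M i) (N i), C.FaninAtMost k →
          1 / Real.exp (γ * Real.sqrt (M i)) ≤ C.averageSuccess (R i) →
          c * Real.log (M i) ≤ C.depth) := by
  -- The exponent 12 is large enough that the `L ^ 9` independent games outweigh √M = L^7, where `L
  -- = i + 1`.
  let eM : ∀ i : ℕ, Fin ((i + 1) ^ 12) × GridGame.Cell i ≃ Fin ((i + 1) ^ 14) := fun i =>
    Fintype.equivFinOfCardEq (by simp only [Fintype.card_prod, Fintype.card_fin]; ring)
  let eN : ∀ i : ℕ, (Fin ((i + 1) ^ 12) × GridGame.Cell i) × Fin 3 ≃ Fin (3 * (i + 1) ^ 14) :=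
    fun i => Fintype.equivFinOfCardEq (by simp only [Fintype.card_prod, Fintype.card_fin]; ring)
  refine ⟨fun i => (i + 1) ^ 14, fun i => 3 * (i + 1) ^ 14,
    fun i => GridGame.relation (eM i) (eN i),
    fun i j hij => Nat.pow_lt_pow_left (Nat.succ_lt_succ hij) (by norm_num),
    ⟨2, 7, fun i => ⟨GridGame.torusCircuit (eM i) (eN i), GridGame.faninAtMost_torusCircuit _ _,
      (GridGame.depth_torusCircuit _ _).le, GridGame.outputProb_torusCircuit _ _⟩⟩,
    -- Replacing `k` by `max k 2` makes the logarithm positive and only weakens the fanin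
    -- constraint.
    1, one_pos, fun k => ⟨1 / (28 * Real.log (max k 2 : ℕ)), ?_, ?_⟩⟩
  · have : 0 < Real.log (max k 2 : ℕ) :=
      Real.log_pos (by exact_mod_cast lt_of_lt_of_le one_lt_two (le_max_right k 2))
    positivity
  · filter_upwards [eventually_ge_atTop 400] with i hi C hC h
    exact GridGame.le_depth_of_averageSuccess_ge (le_max_right k 2) (by omega) rfl rfl
      (eM i) (eN i) C (fun g => (hC g).trans (le_max_left k 2)) h
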